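/- \textbf{Setting.} Let $N\ge 1$, let $f:\mathbb{R}^N\to\mathbb{R}^N$ be a $C^1$ vector field with a globally defined flow $\phi_t$ (so $\frac{d}{dt}\phi_t(x)=f(\phi_t(x))$, $\phi_0(x)=x$), let $X\subset\mathbb{R}^N$ be compact with $m(\partial X)=0$, where $m$ is Lebesgue measure, and let $B\subseteq X$ be measurable. Trajectories are stopped at the boundary of $X$: for $t\in\mathbb{R}$ let $X_t$ be the set of $x$ with $\phi_s(x)\in\operatorname{int}X$ for all $s$ between $0$ and $t$. For $t\ge 0$ define $$(\mathbb{U}_t z)(x)=\begin{cases} z(\phi_t(x)), & x\in X_t,\\ 0, &\text{otherwise,}\end{cases}\qquad (\mathbb{P}_t \rho)(x)=\begin{cases}\rho(\phi_{-t}(x))\,\bigl|\det D\phi_t(\phi_{-t}(x))\bigr|^{-1}, & x\in X_{-t},\\ 0, &\text{otherwise.}\end{cases}$$ The finite-time controllability gramian is $\mathcal{C}_B^\tau z=\int_0^\tau \mathbb{P}_{\tau-s}\bigl(\chi_B\,\mathbb{U}_{\tau-s}z\bigr)\,ds$. The infinite-time controllability gramian $\mathcal{C}_B^\infty$ is the (possibly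 unbounded) operator in $L^2(X)$ whose domain consists of all $z\in L^2(X)$ for which $\mathcal{C}_B^\tau z$ converges in $L^2(X)$ as $\tau\to\infty$, and whose value is that limit. The vector field is \emph{almost everywhere uniformly stable} if $f(0)=0$ and for all $\delta,\epsilon>0$ there is a $T\ge0$ such that, for every measurable $A\subseteq X\setminus B_\delta$ ($B_\delta$ the open ball of radius $\delta$ about $0$), $$\int_T^\infty m(A_t)\,dt<\epsilon,\qquad A_t=\{x\in X\cap X_t:\ \phi_t(x)\in A\}.$$ Let $\Gamma_i$ be the set of points of $\partial X$ near which $\partial X$ is a $C^1$ hypersurface with $X$ on one side and at which $f\cdot\eta<0$, $\eta$ being the outward unit normal. A \emph{weak solution} of $$\nabla\cdot(f\rho)=\chi_B,\qquad \rho|_{\Gamma_i}=0 \qquad (*)$$ on $X\setminus\{0\}$ is a function $\rho$ that is integrable on $X\setminus B_\delta$ for every $\delta>0$ and satisfies $$-\int_X \rho\, f\cdot\nabla\psi\,dx=\int_X\chi_B\,\psi\,dx$$ for every $\psi\in C^1(\mathbb{R}^N)$ that vanishes in a neighbourhood of $0$ and on $\partial X\setminus\Gamma_i$ (but not necessarily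 on $\Gamma_i$). \textbf{Theorem.} Suppose that the vector field $f$ is almost everywhere uniformly stable. Then: 1. For almost every $x\in X$ the function $t\mapsto\mathbb{P}_t\chi_B(x)$ is integrable on $(0,\infty)$; put $\rho_B(x)=\int_0^\infty \mathbb{P}_t\chi_B(x)\,dt$. 2. The infinite-time controllability gramian is the operator of multiplication by $\rho_B$. That is, for every $z\in L^2(X)$, $(\mathcal{C}_B^\tau z)(x)\to\rho_B(x)z(x)$ as $\tau\to\infty$ for almost every $x\in X$; for $z,w\in L^2(X)$, $z$ is in the domain of $\mathcal{C}_B^\infty$ with $\mathcal{C}_B^\infty z=w$ if and only if $w=\rho_B z$ almost everywhere; and the domain of $\mathcal{C}_B^\infty$ is dense in $L^2(X)$. 3. $\rho_B\ge 0$, and for every $t\ge0$, $\rho_B>0$ at almost every point $x\in X\cap X_{-t}$ with $\phi_{-t}(x)\in B$. 4. $\rho_B$ is a weak solution of $(*)$ on $X\setminus\{0\}$, and it is the smallest nonnegative one: if $\rho$ is a weak solution of $(*)$ with $\rho\ge0$ almost everywhere on $X$, then $\rho_B\le\rho$ almost everywhere on $X$. -/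

import Mathlib

open Set Filter Topology MeasureTheory

namespace Advection

noncomputable section

/-- `φ` is the (global) flow of the ordinary differential equation `x' = f x`. -/
structure IsFlow {n : ℕ} (f : EuclideanSpace ℝ (Fin n) → EuclideanSpace ℝ (Fin n))
    (φ : ℝ → EuclideanSpace ℝ (Fin n) → EuclideanSpace ℝ (Fin n)) : Prop where
  zero : ∀ x, φ 0 x = x
  integralCurve : ∀ x, IsIntegralCurve (fun t => φ t x) (fun _ => f)

/-- The trajectory through `x` has not met the boundary of `X` between time `0` and time `t`
(forward in time if `0 ≤ t`, backward in time if `t ≤ 0`). -/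
def Alive {n : ℕ} (φ : ℝ → EuclideanSpace ℝ (Fin n) → EuclideanSpace ℝ (Fin n))
    (X : Set (EuclideanSpace ℝ (Fin n))) (t : ℝ) (x : EuclideanSpace ℝ (Fin n)) : Prop :=
  ∀ s ∈ uIcc 0 t, φ s x ∈ interior X

open Classical in
/-- The Koopman operators `U_t` with zero outflow boundary condition: `(U_t z)(x) = z(φ_t x)`, and
`0` if the trajectory of `x` has left `X` before time `t`. -/
def koopman {n : ℕ} (φ : ℝ → EuclideanSpace ℝ (Fin n) → EuclideanSpace ℝ (Fin n))
    (X : Set (EuclideanSpace ℝ (Fin n))) (t : ℝ) (z : EuclideanSpace ℝ (Fin n) → ℝ)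
    (x : EuclideanSpace ℝ (Fin n)) : ℝ :=
  if Alive φ X t x then z (φ t x) else 0

open Classical in
/-- The Perron-Frobenius operators `P_t` with zero inflow boundary condition:
`(P_t ρ)(x) = ρ(φ_{-t} x) |det Dφ_t|⁻¹`, the determinant being taken at the point `φ_{-t} x` that
is transported to `x`, and `0` if the trajectory arriving at `x` entered `X` less than `t` ago. -/
def perronFrobenius {n : ℕ} (φ : ℝ → EuclideanSpace ℝ (Fin n) → EuclideanSpace ℝ (Fin n))
    (X : Set (EuclideanSpace ℝ (Fin n))) (t : ℝ) (ρ : EuclideanSpace ℝ (Fin n) → ℝ)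
    (x : EuclideanSpace ℝ (Fin n)) : ℝ :=
  if Alive φ X (-t) x then ρ (φ (-t) x) * |(fderiv ℝ (φ t) (φ (-t) x)).det|⁻¹ else 0

/-- The controllability operator `(ℬ^τ u)(x) = ∫_0^τ P_{τ-s} (χ_B u(·,s))(x) ds`. -/
def controllabilityOp {n : ℕ} (φ : ℝ → EuclideanSpace ℝ (Fin n) → EuclideanSpace ℝ (Fin n))
    (X B : Set (EuclideanSpace ℝ (Fin n))) (τ : ℝ) (u : ℝ → EuclideanSpace ℝ (Fin n) → ℝ)
    (x : EuclideanSpace ℝ (Fin n)) : ℝ :=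
  ∫ s in (0 : ℝ)..τ, perronFrobenius φ X (τ - s) (B.indicator (u s)) x

/-- The adjoint of the controllability operator, `(ℬ^{τ*} z)(x,s) = χ_B(x) (U_{τ-s} z)(x)`. -/
def controllabilityAdj {n : ℕ} (φ : ℝ → EuclideanSpace ℝ (Fin n) → EuclideanSpace ℝ (Fin n))
    (X B : Set (EuclideanSpace ℝ (Fin n))) (τ : ℝ) (z : EuclideanSpace ℝ (Fin n) → ℝ)
    (s : ℝ) : EuclideanSpace ℝ (Fin n) → ℝ :=
  B.indicator (koopman φ X (τ - s) z)

/-- The finite-time controllability gramian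
`C_B^τ z = ℬ^τ ℬ^{τ*} z = ∫_0^τ P_{τ-s} (χ_B U_{τ-s} z) ds`. -/
def gramian {n : ℕ} (φ : ℝ → EuclideanSpace ℝ (Fin n) → EuclideanSpace ℝ (Fin n))
    (X B : Set (EuclideanSpace ℝ (Fin n))) (τ : ℝ) (z : EuclideanSpace ℝ (Fin n) → ℝ) :
    EuclideanSpace ℝ (Fin n) → ℝ :=
  controllabilityOp φ X B τ (controllabilityAdj φ X B τ z)

/-- The graph of the infinite-time controllability gramian `C_B^∞`, an operator in `L²(X)` that is
in general unbounded: `z` is in its domain, with `C_B^∞ z = w`, iff `C_B^τ z → w` in `L²(X)` as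
`τ → ∞`. -/
def infiniteGramianGraph {n : ℕ} (φ : ℝ → EuclideanSpace ℝ (Fin n) → EuclideanSpace ℝ (Fin n))
    (X B : Set (EuclideanSpace ℝ (Fin n))) :
    Set (Lp ℝ 2 ((volume : Measure (EuclideanSpace ℝ (Fin n))).restrict X) ×
      Lp ℝ 2 ((volume : Measure (EuclideanSpace ℝ (Fin n))).restrict X)) :=
  {p | Tendsto (fun τ : ℝ => eLpNorm (fun x => gramian φ X B τ p.1 x - p.2 x) 2
    (volume.restrict X)) atTop (𝓝 0)}

/-- `ρ_B = ∫_0^∞ P_t χ_B dt`. -/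
def rhoB {n : ℕ} (φ : ℝ → EuclideanSpace ℝ (Fin n) → EuclideanSpace ℝ (Fin n))
    (X B : Set (EuclideanSpace ℝ (Fin n))) (x : EuclideanSpace ℝ (Fin n)) : ℝ :=
  ∫ t in Ioi (0 : ℝ), perronFrobenius φ X t (B.indicator 1) x

/-- `0` is an equilibrium that is almost everywhere uniformly stable on `X`: for every `δ`
and `ε` there is a time `T` with `∫_T^∞ m(A_t) dt < ε` for all measurable `A ⊆ X \ B_δ`, where
`A_t` is the set of the points of `X` that are in `A` at time `t`. -/
def AEUniformlyStable {n : ℕ} (f : EuclideanSpace ℝ (Fin n) → EuclideanSpace ℝ (Fin n))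
    (φ : ℝ → EuclideanSpace ℝ (Fin n) → EuclideanSpace ℝ (Fin n))
    (X : Set (EuclideanSpace ℝ (Fin n))) : Prop :=
  f 0 = 0 ∧ ∀ δ > 0, ∀ ε > 0, ∃ T : ℝ, 0 ≤ T ∧
    ∀ A : Set (EuclideanSpace ℝ (Fin n)), MeasurableSet A → A ⊆ X \ Metric.ball 0 δ →
      ∫⁻ t in Ioi T, volume {x ∈ X | Alive φ X t x ∧ φ t x ∈ A} < ENNReal.ofReal ε

/-- Near `p`, the boundary of `X` is a `C¹` hypersurface with `X` on one side, and `η` is the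
outward unit normal to `X` at `p`. -/
def IsOutwardNormalAt {n : ℕ} (X : Set (EuclideanSpace ℝ (Fin n)))
    (p η : EuclideanSpace ℝ (Fin n)) : Prop :=
  ‖η‖ = 1 ∧ ∃ r : EuclideanSpace ℝ (Fin n) → ℝ, ContDiffAt ℝ 1 r p ∧
    (∃ c > (0 : ℝ), gradient r p = c • η) ∧ ∀ᶠ x in 𝓝 p, (x ∈ X ↔ r x ≤ 0)

/-- The inflow portion `Γ_i = {x ∈ ∂X : f · η < 0}` of the boundary. -/
def inflow {n : ℕ} (f : EuclideanSpace ℝ (Fin n) → EuclideanSpace ℝ (Fin n))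
    (X : Set (EuclideanSpace ℝ (Fin n))) : Set (EuclideanSpace ℝ (Fin n)) :=
  {p ∈ frontier X | ∃ η, IsOutwardNormalAt X p η ∧ inner ℝ (f p) η < 0}

/-- `ρ` is a weak solution on `X \ {0}` of `∇·(f ρ) = h`, `ρ = 0` on the inflow boundary `Γ_i`.
The test functions need not vanish on `Γ_i`: this is the boundary condition. -/
structure IsWeakSolution {n : ℕ} (f : EuclideanSpace ℝ (Fin n) → EuclideanSpace ℝ (Fin n))
    (X : Set (EuclideanSpace ℝ (Fin n))) (h ρ : EuclideanSpace ℝ (Fin n) → ℝ) : Prop where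
  integrable : ∀ δ > 0, IntegrableOn ρ (X \ Metric.ball 0 δ)
  weak : ∀ ψ : EuclideanSpace ℝ (Fin n) → ℝ, ContDiff ℝ 1 ψ → 0 ∉ tsupport ψ →
    (∀ x ∈ frontier X \ inflow f X, ψ x = 0) →
    -∫ x in X, ρ x * fderiv ℝ ψ x (f x) = ∫ x in X, h x * ψ x

end

end Advection

/-! Everything rests on reading `ρ_B dx` as an occupation measure. The change of variables `x =
φ_t(y)` gives `∫ (P_t χ_B) g = ∫ g(φ_t y) dy`, over those `y ∈ B` still alive at time `t`
(`lintegral_perronFrobenius_mul`). Integrating in `t`, the density `∫ P_t χ_B dt` is that of the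
push-forward of `dt × dy` on living trajectories from `B` (`withDensity_rhoOn`). Stability says
precisely that this measure is finite away from `0`, and `{0}` is null, so `ρ_B` is finite almost
everywhere.

Gramian: `U_t` evaluates `z` at `φ_t` and `P_t` pulls back by `φ_{-t}`, so `P_t(χ_B U_t z) = (P_t
χ_B) z`. The finite-time gramian is thus multiplication by `∫_0^τ P_t χ_B dt`, which increases to
`ρ_B`; the rest is dominated convergence and truncation.

Positivity: almost every point of `B` was in `B` for a set of recent times of positive measure.

Weak equation: against `ρ_B`, the function `f · ∇ψ` becomes its integral along orbits, which
telescopes to `-ψ(y)`. An orbit either leaves `X` at a boundary point outside `Γ_i`, where `ψ = 0`,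
or never leaves, and then `ψ → 0` along it by integrability.

Minimality: test `ρ` with `ψ = ∫_0^τ g ∘ φ_t dt`, for which `f · ∇ψ = g ∘ φ_τ - g`. Then `∫ ρ g =
∫_B ψ + ∫ ρ (g ∘ φ_τ) ≥ ∫_B ψ ≥ ∫ (∫_0^τ P_t χ_B dt) g`. Localising `g` and exhausting the survival
times gives `ρ_B ≤ ρ`. -/

namespace Advection

/-! ### Uniqueness, the group law and local continuity of the flow. -/

section SmoothFlow

variable {E F : Type*} [NormedAddCommGroup E] [NormedSpace ℝ E]
  [NormedAddCommGroup F] [NormedSpace ℝ F]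

/-- A two-sided Grönwall inequality. -/
theorem norm_le_of_norm_deriv_le {y y' : ℝ → F} {K η ε : ℝ} (hK : 1 ≤ K) (hη : 0 ≤ η)
    (hy : ∀ t ∈ Ioo (-ε) ε, HasDerivAt y (y' t) t)
    (bound : ∀ t ∈ Ioo (-ε) ε, ‖y' t‖ ≤ K * ‖y t‖ + η) :
    ∀ t ∈ Ioo (-ε) ε, ‖y t‖ ≤ (‖y 0‖ + η) * Real.exp (K * ε) := by
  have aux : ∀ (z z' : ℝ → F), (∀ t ∈ Ioo (-ε) ε, HasDerivAt z (z' t) t) →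
      (∀ t ∈ Ioo (-ε) ε, ‖z' t‖ ≤ K * ‖z t‖ + η) →
      ∀ t ∈ Ico 0 ε, ‖z t‖ ≤ (‖z 0‖ + η) * Real.exp (K * ε) := by
    intro z z' hz hb t ht
    have hmem : ∀ s ∈ Icc 0 t, s ∈ Ioo (-ε) ε := fun s hs =>
      ⟨by linarith [hs.1, ht.1, ht.2], by linarith [hs.2, ht.2]⟩
    have h := norm_le_gronwallBound_of_norm_deriv_right_le (f := z) (f' := z') (δ := ‖z 0‖)
      (K := K) (ε := η) (a := 0) (b := t)
      (fun s hs => (hz s (hmem s hs)).continuousAt.continuousWithinAt)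
      (fun s hs => (hz s (hmem s (Ico_subset_Icc_self hs))).hasDerivWithinAt) le_rfl
      (fun s hs => hb s (hmem s (Ico_subset_Icc_self hs))) t ⟨ht.1, le_rfl⟩
    -- The assumption `1 ≤ K` excludes the degenerate form of the bound and allows `η / K` to be
    -- replaced by `η`.
    rw [gronwallBound_of_K_ne_0 (by linarith), sub_zero] at h
    have h1 : Real.exp (K * t) ≤ Real.exp (K * ε) :=
      Real.exp_le_exp.2 (mul_le_mul_of_nonneg_left ht.2.le (by linarith))
    have h2 : η / K ≤ η := div_le_self hη hK
    have h3 : (0 : ℝ) ≤ η / K := div_nonneg hη (by linarith)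
    have h4 : 0 < Real.exp (K * t) := Real.exp_pos _
    calc ‖z t‖ ≤ _ := h
      _ ≤ (‖z 0‖ + η / K) * Real.exp (K * t) := by nlinarith
      _ ≤ _ := by gcongr
  intro t ht
  rcases le_total 0 t with h0 | h0
  · exact aux y y' hy bound t ⟨h0, ht.2⟩
  · have hneg : ∀ s ∈ Ioo (-ε) ε, -s ∈ Ioo (-ε) ε := fun s hs =>
      ⟨by linarith [hs.2], by linarith [hs.1]⟩
    have := aux (fun s => y (-s)) (fun s => -y' (-s)) (fun s hs => ?_) (fun s hs => ?_) (-t)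
      ⟨by linarith, by linarith [ht.1]⟩
    · simpa using this
    · simpa using! (hy (-s) (hneg s hs)).scomp s (hasDerivAt_neg s)
    · simpa using bound (-s) (hneg s hs)

variable [FiniteDimensional ℝ E] {f : E → E} {φ : ℝ → E → E}

/-- A `C¹` field is only locally Lipschitz. On a compact subinterval around `t₀` and `t` both curves
stay in one closed ball, where `f` is Lipschitz and the standard uniqueness theorem applies. -/
theorem eqOn_Ioo_of_hasDerivAt (hf : ContDiff ℝ 1 f) {a b t₀ : ℝ} (ht₀ : t₀ ∈ Ioo a b)
    {γ δ : ℝ → E} (hγ : ∀ t ∈ Ioo a b, HasDerivAt γ (f (γ t)) t)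
    (hδ : ∀ t ∈ Ioo a b, HasDerivAt δ (f (δ t)) t) (h0 : γ t₀ = δ t₀) : EqOn γ δ (Ioo a b) := by
  intro t ht
  obtain ⟨a', ha'⟩ := exists_between (lt_min ht₀.1 ht.1)
  obtain ⟨b', hb'⟩ := exists_between (max_lt ht₀.2 ht.2)
  have hsub : Icc a' b' ⊆ Ioo a b := fun s hs =>
    ⟨ha'.1.trans_le hs.1, hs.2.trans_lt hb'.2⟩
  have hcγ : IsCompact (γ '' Icc a' b') := isCompact_Icc.image_of_continuousOn
    fun s hs => (hγ s (hsub hs)).continuousAt.continuousWithinAt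
  have hcδ : IsCompact (δ '' Icc a' b') := isCompact_Icc.image_of_continuousOn
    fun s hs => (hδ s (hsub hs)).continuousAt.continuousWithinAt
  obtain ⟨R, hR⟩ := (hcγ.union hcδ).isBounded.subset_closedBall (0 : E)
  have := FiniteDimensional.proper ℝ E
  obtain ⟨K, hK⟩ := (hf.contDiffOn (s := Metric.closedBall (0 : E) R)).exists_lipschitzOnWith
    one_ne_zero (convex_closedBall 0 R) (isCompact_closedBall _ _)
  refine ODE_solution_unique_of_mem_Ioo (v := fun _ => f) (s := fun _ => Metric.closedBall 0 R)
    (a := a') (b := b') (t₀ := t₀) (fun _ _ => hK) ?_ (fun s hs => ?_) (fun s hs => ?_) h0 ?_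
  · exact ⟨ha'.2.trans_le (min_le_left _ _), (le_max_left _ _).trans_lt hb'.1⟩
  · have hs' := Ioo_subset_Icc_self hs
    exact ⟨hγ s (hsub hs'), hR (Or.inl (mem_image_of_mem _ hs'))⟩
  · have hs' := Ioo_subset_Icc_self hs
    exact ⟨hδ s (hsub hs'), hR (Or.inr (mem_image_of_mem _ hs'))⟩
  · exact ⟨ha'.2.trans_le (min_le_right _ _), (le_max_right _ _).trans_lt hb'.1⟩

/-- The group property of the flow. -/
theorem flow_add (hf : ContDiff ℝ 1 f) (h0 : ∀ x, φ 0 x = x)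
    (h1 : ∀ x t, HasDerivAt (fun t => φ t x) (f (φ t x)) t) (s t : ℝ) (x : E) :
    φ (s + t) x = φ s (φ t x) := by
  have hmem : (0 : ℝ) ∈ Ioo (-(|s| + 1)) (|s| + 1) :=
    ⟨by linarith [abs_nonneg s], by linarith [abs_nonneg s]⟩
  refine eqOn_Ioo_of_hasDerivAt hf (γ := fun s => φ (s + t) x) (δ := fun s => φ s (φ t x)) hmem
    (fun u _ => ?_) (fun u _ => h1 _ u) (by simp [h0])
    ⟨by linarith [neg_abs_le s], by linarith [le_abs_self s]⟩
  simpa using! (h1 x (u + t)).scomp u ((hasDerivAt_id u).add_const t)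

/-- Picard-Lindelöf yields a local family of solutions jointly continuous in time and initial value;
uniqueness identifies it with `φ`. -/
theorem exists_flow_continuousOn (hf : ContDiff ℝ 1 f) (h0 : ∀ x, φ 0 x = x)
    (h1 : ∀ x t, HasDerivAt (fun t => φ t x) (f (φ t x)) t) (p : E) :
    ∃ ε > 0, ContinuousOn (fun q : ℝ × E => φ q.1 q.2) (Ioo (-ε) ε ×ˢ Metric.ball p ε) := by
  have : CompleteSpace E := FiniteDimensional.complete ℝ E
  obtain ⟨ε, hε, a, r, L, K, hr, hpl⟩ := IsPicardLindelof.of_contDiffAt_one (hf.contDiffAt (x := p))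
  obtain ⟨α, hα, hαc⟩ := (hpl 0).exists_forall_mem_closedBall_eq_hasDerivWithinAt_continuousOn
  refine ⟨min ε r, lt_min hε hr, ?_⟩
  have key : ∀ x ∈ Metric.closedBall p r, ∀ t ∈ Ioo (0 - ε) (0 + ε), φ t x = α (x, t) := by
    intro x hx t ht
    refine eqOn_Ioo_of_hasDerivAt hf (t₀ := 0) (by simp [hε]) (γ := fun t => φ t x)
      (δ := fun t => α (x, t))
      (fun t _ => h1 x t) (fun t ht => ?_) (by rw [h0]; exact (hα x hx).1.symm) ht
    exact ((hα x hx).2 t (Ioo_subset_Icc_self ht)).hasDerivAt (Icc_mem_nhds ht.1 ht.2)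
  have hsub : ∀ q ∈ Ioo (-(min ε r : ℝ)) (min ε r) ×ˢ Metric.ball p (min ε r),
      q.2 ∈ Metric.closedBall p r ∧ q.1 ∈ Ioo (0 - ε) (0 + ε) := by
    rintro ⟨t, x⟩ ⟨ht, hx⟩
    refine ⟨Metric.ball_subset_closedBall (Metric.ball_subset_ball (min_le_right _ _) hx), ?_⟩
    have := min_le_left ε (r : ℝ)
    exact ⟨by linarith [ht.1], by linarith [ht.2]⟩
  have hc : ContinuousOn (fun q : ℝ × E => α (q.2, q.1))
      (Ioo (-(min ε r : ℝ)) (min ε r) ×ˢ Metric.ball p (min ε r)) :=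
    hαc.comp (by fun_prop) fun q hq => ⟨(hsub q hq).1, Ioo_subset_Icc_self (hsub q hq).2⟩
  exact hc.congr fun q hq => key _ (hsub q hq).1 _ (hsub q hq).2

end SmoothFlow

/-! ### Joint `C¹` regularity of the flow. -/

section SmoothFlow

variable {E : Type*} [NormedAddCommGroup E] [NormedSpace ℝ E] [FiniteDimensional ℝ E]
  {f : E → E} {φ : ℝ → E → E}

/-- Short-time existence of the fundamental solution of a linear differential equation. -/
theorem exists_fundamental_solution {A : ℝ → E →L[ℝ] E} {K ε : ℝ} (hε : 0 < ε)
    (hA : ContinuousOn A (Icc (-ε) ε)) (hK : ∀ t ∈ Icc (-ε) ε, ‖A t‖ ≤ K) (hKε : 2 * K * ε ≤ 1) :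
    ∃ M : ℝ → E →L[ℝ] E, M 0 = ContinuousLinearMap.id ℝ E ∧
      ∀ t ∈ Ioo (-ε) ε, HasDerivAt M ((A t).comp (M t)) t := by
  have : CompleteSpace E := FiniteDimensional.complete ℝ E
  have hK0 : 0 ≤ K := (norm_nonneg _).trans (hK 0 ⟨by linarith, hε.le⟩)
  -- In the unit ball about the identity `‖M‖ ≤ 2`, so the speed is at most `2 * K`, and `2 * K * ε
  -- ≤ 1` keeps the solution in that ball.
  have hpl : IsPicardLindelof (fun t (M : E →L[ℝ] E) => (A t).comp M) (tmin := -ε) (tmax := ε)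
      ⟨0, by linarith, hε.le⟩ (ContinuousLinearMap.id ℝ E) 1 0 ⟨2 * K, by linarith⟩ ⟨K, hK0⟩ := by
    refine ⟨fun t ht => ?_, fun M _ => ?_, fun t ht M hM => ?_, ?_⟩
    · refine LipschitzOnWith.of_dist_le_mul fun M _ N _ => ?_
      rw [dist_eq_norm, dist_eq_norm, ← ContinuousLinearMap.comp_sub]
      exact (ContinuousLinearMap.opNorm_comp_le _ _).trans
        (mul_le_mul_of_nonneg_right (hK t ht) (norm_nonneg _))
    · exact hA.clm_comp continuousOn_const
    · have h1 : ‖M‖ ≤ 2 := by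
        have h2 : ‖M - ContinuousLinearMap.id ℝ E‖ ≤ 1 := by simpa [dist_eq_norm] using hM
        have h3 := norm_le_norm_sub_add M (ContinuousLinearMap.id ℝ E)
        have h4 : ‖ContinuousLinearMap.id ℝ E‖ ≤ 1 := ContinuousLinearMap.norm_id_le
        linarith
      calc ‖(A t).comp M‖ ≤ ‖A t‖ * ‖M‖ := ContinuousLinearMap.opNorm_comp_le _ _
        _ ≤ K * 2 := mul_le_mul (hK t ht) h1 (norm_nonneg _) hK0
        _ = 2 * K := mul_comm _ _
    · change 2 * K * max (ε - 0) (0 - -ε) ≤ ((1 : NNReal) : ℝ) - ((0 : NNReal) : ℝ)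
      simpa using hKε
  obtain ⟨M, hM0, hM⟩ := hpl.exists_eq_forall_mem_Icc_hasDerivWithinAt₀
  exact ⟨M, hM0, fun t ht => (hM t (Ioo_subset_Icc_self ht)).hasDerivAt (Icc_mem_nhds ht.1 ht.2)⟩

/-- A family of trajectories that stays in a ball on which `Df` is bounded depends
differentiably on the initial value. -/
theorem exists_hasFDerivAt_flow (hf : ContDiff ℝ 1 f) (h0 : ∀ x, φ 0 x = x)
    (h1 : ∀ x t, HasDerivAt (fun t => φ t x) (f (φ t x)) t) {p : E} {K ε r : ℝ}
    (hε : 0 < ε) (hK1 : 1 ≤ K) (hKε : 2 * K * ε ≤ 1)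
    (hK : ∀ x ∈ Metric.closedBall p r, ‖fderiv ℝ f x‖ ≤ K)
    (hφ : ∀ t ∈ Icc (-ε) ε, ∀ x ∈ Metric.ball p ε, φ t x ∈ Metric.closedBall p r) :
    ∃ M : ℝ → E → E →L[ℝ] E,
      ContinuousOn (fun q : ℝ × E => M q.1 q.2) (Ioo (-ε) ε ×ˢ Metric.ball p ε) ∧
      ∀ t ∈ Ioo (-ε) ε, ∀ x ∈ Metric.ball p ε, HasFDerivAt (φ t) (M t x) x := by
  have := FiniteDimensional.proper ℝ E
  have hDf : Continuous (fderiv ℝ f) := hf.continuous_fderiv one_ne_zero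
  have hdiff : Differentiable ℝ f := hf.differentiable one_ne_zero
  have hsub := Ioo_subset_Icc_self (a := -ε) (b := ε)
  -- The candidate derivative solves the variational equation `M' = Df(φ_t x) M`.
  have hexist : ∀ x ∈ Metric.ball p ε, ∃ M : ℝ → E →L[ℝ] E, M 0 = ContinuousLinearMap.id ℝ E ∧
      ∀ t ∈ Ioo (-ε) ε, HasDerivAt M ((fderiv ℝ f (φ t x)).comp (M t)) t := fun x hx =>
    exists_fundamental_solution hε
      (hDf.comp (continuous_iff_continuousAt.2 fun t => (h1 x t).continuousAt)).continuousOn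
      (fun t ht => hK _ (hφ t ht x hx)) hKε
  choose! M hM0 hM using hexist
  set C := Real.exp (K * ε) with hC
  have hC0 : 0 < C := Real.exp_pos _
  have hMC : ∀ x ∈ Metric.ball p ε, ∀ t ∈ Ioo (-ε) ε, ‖M x t‖ ≤ C := by
    intro x hx t ht
    have h := norm_le_of_norm_deriv_le hK1 le_rfl (hM x hx) (fun s hs => ?_) t ht
    · rw [hM0 x hx, add_zero] at h
      exact h.trans (mul_le_of_le_one_left hC0.le ContinuousLinearMap.norm_id_le)
    · rw [add_zero]
      exact (ContinuousLinearMap.opNorm_comp_le _ _).trans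
        (mul_le_mul_of_nonneg_right (hK _ (hφ s (hsub hs) x hx)) (norm_nonneg _))
  have hLip : ∀ x ∈ Metric.ball p ε, ∀ y ∈ Metric.ball p ε, ∀ t ∈ Ioo (-ε) ε,
      ‖φ t y - φ t x‖ ≤ C * ‖y - x‖ := by
    intro x hx y hy t ht
    have h := norm_le_of_norm_deriv_le hK1 le_rfl (fun s _ => (h1 y s).sub (h1 x s))
      (fun s hs => ?_) t ht
    · simpa [h0, mul_comm] using h
    · simpa using (convex_closedBall p r).norm_image_sub_le_of_norm_fderiv_le
        (fun z _ => hdiff z) hK (hφ s (hsub hs) x hx) (hφ s (hsub hs) y hy)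
  have hunif : ∀ η > 0, ∃ δ > 0, ∀ a ∈ Metric.closedBall p r, ∀ b ∈ Metric.closedBall p r,
      dist a b < δ → ‖fderiv ℝ f a - fderiv ℝ f b‖ ≤ η := by
    intro η hη
    obtain ⟨δ, hδ, h⟩ := Metric.uniformContinuousOn_iff.1
      ((isCompact_closedBall p r).uniformContinuousOn_of_continuous hDf.continuousOn) η hη
    exact ⟨δ, hδ, fun a ha b hb hab => by rw [← dist_eq_norm]; exact (h a ha b hb hab).le⟩
  -- Both quantities vanish at time `0` and solve the variational equation at `x` up to an error of
  -- size `η * C * ‖y - x‖`, respectively `η * C`, where `η` bounds the oscillation of `Df`;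
  -- Grönwall contributes the second factor `C`.
  have hnear : ∀ η > 0, ∀ x ∈ Metric.ball p ε, ∀ᶠ y in 𝓝 x, y ∈ Metric.ball p ε ∧
      ∀ t ∈ Ioo (-ε) ε,
        ‖φ t y - φ t x - M x t (y - x)‖ ≤ η * C * C * ‖y - x‖ ∧ ‖M y t - M x t‖ ≤ η * C * C := by
    intro η hη x hx
    obtain ⟨δ, hδ, hun⟩ := hunif η hη
    filter_upwards [Metric.isOpen_ball.mem_nhds hx, Metric.ball_mem_nhds x (div_pos hδ hC0)]
      with y hy hyx
    refine ⟨hy, fun t ht => ?_⟩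
    have hyd : ∀ s ∈ Ioo (-ε) ε, dist (φ s y) (φ s x) < δ := by
      intro s hs
      rw [dist_eq_norm]
      refine (hLip x hx y hy s hs).trans_lt ?_
      rw [Metric.mem_ball, dist_eq_norm, lt_div_iff₀ hC0] at hyx
      linarith
    constructor
    · have h := norm_le_of_norm_deriv_le (η := η * C * ‖y - x‖) hK1 (by positivity)
        (fun s hs => ((h1 y s).sub (h1 x s)).sub ((hM x hx s hs).clm_apply
          (hasDerivAt_const s (y - x)))) (fun s hs => ?_) t ht
      · refine h.trans (le_of_eq ?_)
        simp [h0, hM0 x hx]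
        ring
      · have hys := hφ s (hsub hs) y hy
        have hxs := hφ s (hsub hs) x hx
        have hrem : ‖f (φ s y) - f (φ s x) - fderiv ℝ f (φ s x) (φ s y - φ s x)‖ ≤
            η * ‖φ s y - φ s x‖ := by
          refine Convex.norm_image_sub_le_of_norm_hasFDerivWithin_le'
            (s := Metric.closedBall p r ∩ Metric.ball (φ s x) δ)
            (fun z _ => (hdiff z).hasFDerivAt.hasFDerivWithinAt) (fun z hz => ?_)
            ((convex_closedBall _ _).inter (convex_ball _ _)) ⟨hxs, Metric.mem_ball_self hδ⟩
            ⟨hys, hyd s hs⟩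
          exact hun z hz.1 _ hxs hz.2
        have hA := hK _ hxs
        have e : f (φ s y) - f (φ s x) - (((fderiv ℝ f (φ s x)).comp (M x s)) (y - x) +
              (M x s) 0) =
            fderiv ℝ f (φ s x) (φ s y - φ s x - M x s (y - x)) +
            (f (φ s y) - f (φ s x) - fderiv ℝ f (φ s x) (φ s y - φ s x)) := by
          simp
        rw [e]
        refine (norm_add_le _ _).trans (add_le_add ?_ (hrem.trans ?_))
        · exact (ContinuousLinearMap.le_opNorm _ _).trans
            (mul_le_mul_of_nonneg_right hA (norm_nonneg _))
        · rw [mul_assoc]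
          exact mul_le_mul_of_nonneg_left (hLip x hx y hy s hs) hη.le
    · have h := norm_le_of_norm_deriv_le (η := η * C) hK1 (by positivity)
        (fun s hs => (hM y hy s hs).sub (hM x hx s hs)) (fun s hs => ?_) t ht
      · simpa [hM0 x hx, hM0 y hy] using h
      · have hys := hφ s (hsub hs) y hy
        have hxs := hφ s (hsub hs) x hx
        have e : (fderiv ℝ f (φ s y)).comp (M y s) - (fderiv ℝ f (φ s x)).comp (M x s) =
            (fderiv ℝ f (φ s x)).comp (M y s - M x s) +
            (fderiv ℝ f (φ s y) - fderiv ℝ f (φ s x)).comp (M y s) := by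
          rw [ContinuousLinearMap.comp_sub, ContinuousLinearMap.sub_comp]
          abel
        rw [e]
        refine (norm_add_le _ _).trans (add_le_add ?_ ?_)
        · exact (ContinuousLinearMap.opNorm_comp_le _ _).trans
            (mul_le_mul_of_nonneg_right (hK _ hxs) (norm_nonneg _))
        · exact (ContinuousLinearMap.opNorm_comp_le _ _).trans
            (mul_le_mul (hun _ hys _ hxs (hyd s hs)) (hMC y hy s hs) (norm_nonneg _) hη.le)
  refine ⟨fun t x => M x t, ?_, ?_⟩
  · rintro ⟨t, x⟩ ⟨ht, hx⟩
    refine ContinuousAt.continuousWithinAt (Metric.tendsto_nhds.2 fun c hc => ?_)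
    have hη : 0 < c / (2 * (C * C)) := by positivity
    have h2 := Metric.tendsto_nhds.1 (hM x hx t ht).continuousAt (c / 2) (by positivity)
    rw [nhds_prod_eq]
    filter_upwards [(h2.and (isOpen_Ioo.mem_nhds ht)).prod_mk (hnear _ hη x hx)] with q hq
    have h3 := (hq.2.2 q.1 hq.1.2).2
    have h4 : c / (2 * (C * C)) * C * C = c / 2 := by field_simp
    rw [h4, ← dist_eq_norm] at h3
    have := dist_triangle (M q.2 q.1) (M x q.1) (M x t)
    linarith [hq.1.1]
  · intro t ht x hx
    refine .of_isLittleO (Asymptotics.isLittleO_iff.2 fun c hc => ?_)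
    have hη : 0 < c / (C * C) := by positivity
    filter_upwards [hnear _ hη x hx] with y hy
    have h4 : c / (C * C) * C * C = c := by field_simp
    simpa only [h4] using (hy.2 t ht).1

/-- Joint continuity confines short nearby trajectories to a ball where `Df` is bounded. Both
partial derivatives then exist and are continuous, which gives joint differentiability. -/
theorem contDiffAt_flow_zero (hf : ContDiff ℝ 1 f) (h0 : ∀ x, φ 0 x = x)
    (h1 : ∀ x t, HasDerivAt (fun t => φ t x) (f (φ t x)) t) (p : E) :
    ContDiffAt ℝ 1 (fun q : ℝ × E => φ q.1 q.2) (0, p) := by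
  have := FiniteDimensional.proper ℝ E
  obtain ⟨ε₁, hε₁, hcont⟩ := exists_flow_continuousOn hf h0 h1 p
  obtain ⟨K₀, hK₀⟩ := (isCompact_closedBall p 1).exists_bound_of_continuousOn
    (hf.continuous_fderiv one_ne_zero).continuousOn
  have hbdd : ∀ᶠ q : ℝ × E in 𝓝 (0, p), φ q.1 q.2 ∈ Metric.closedBall p 1 := by
    have hc : ContinuousAt (fun q : ℝ × E => φ q.1 q.2) (0, p) := hcont.continuousAt
      ((isOpen_Ioo.prod Metric.isOpen_ball).mem_nhds ⟨by simpa using hε₁, Metric.mem_ball_self hε₁⟩)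
    refine hc (Metric.closedBall_mem_nhds_of_mem ?_)
    simp [h0]
  obtain ⟨ε₂, hε₂, hball⟩ := Metric.eventually_nhds_iff_ball.1 hbdd
  set K := max 1 K₀ with hKdef
  have hK1 : 1 ≤ K := le_max_left _ _
  -- The three bounds ensure continuity, confinement up to the closed endpoints `±ε`, and `2 * K * ε
  -- ≤ 1`.
  set ε := min (min ε₁ (ε₂ / 2)) (1 / (2 * K)) with hεdef
  have hε : 0 < ε := by positivity
  have hεε₁ : ε ≤ ε₁ := (min_le_left _ _).trans (min_le_left _ _)
  have hεε₂ : ε ≤ ε₂ / 2 := (min_le_left _ _).trans (min_le_right _ _)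
  have hKε : 2 * K * ε ≤ 1 := by
    have : ε ≤ 1 / (2 * K) := min_le_right _ _
    rw [le_div_iff₀ (by positivity)] at this
    linarith
  obtain ⟨M, hMc, hM⟩ := exists_hasFDerivAt_flow hf h0 h1 hε hK1 hKε
    (fun x hx => (hK₀ x hx).trans (le_max_right _ _)) (fun t ht x hx => by
      refine hball (t, x) ?_
      rw [← ball_prod_same]
      refine ⟨?_, Metric.ball_subset_ball (by linarith) hx⟩
      rw [Metric.mem_ball, Real.dist_eq, sub_zero]
      exact (abs_le.2 ht).trans_lt (by linarith))
  have hopen : IsOpen (Ioo (-ε) ε ×ˢ Metric.ball p ε) := isOpen_Ioo.prod Metric.isOpen_ball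
  have hφc : ContinuousOn (fun q : ℝ × E => φ q.1 q.2) (Ioo (-ε) ε ×ˢ Metric.ball p ε) :=
    hcont.mono (prod_mono (Ioo_subset_Ioo (by linarith) hεε₁) (Metric.ball_subset_ball hεε₁))
  have hDc : ContinuousOn (fun q : ℝ × E => ContinuousLinearMap.toSpanSingleton ℝ (f (φ q.1 q.2)))
      (Ioo (-ε) ε ×ˢ Metric.ball p ε) :=
    (ContinuousLinearMap.toSpanSingletonCLE (𝕜 := ℝ) (E := E)).continuous.comp_continuousOn
      (hf.continuous.comp_continuousOn hφc)
  refine contDiffAt_one_iff.2 ⟨fun q =>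
    (ContinuousLinearMap.toSpanSingleton ℝ (f (φ q.1 q.2))).coprod (M q.1 q.2), _,
    hopen.mem_nhds ⟨by simpa using hε, Metric.mem_ball_self hε⟩, ?_, fun q hq => ?_⟩
  · have e : ∀ q : ℝ × E,
        (ContinuousLinearMap.toSpanSingleton ℝ (f (φ q.1 q.2))).coprod (M q.1 q.2) =
        (ContinuousLinearMap.toSpanSingleton ℝ (f (φ q.1 q.2))).comp
          (ContinuousLinearMap.fst ℝ ℝ E) + (M q.1 q.2).comp (ContinuousLinearMap.snd ℝ ℝ E) :=
      fun q => by ext <;> simp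
    simp only [e]
    exact (hDc.clm_comp continuousOn_const).add (hMc.clm_comp continuousOn_const)
  · have hU := hopen.mem_nhds hq
    exact (hasStrictFDerivAt_uncurry_coprod (f := φ)
      (f₁ := fun t x => ContinuousLinearMap.toSpanSingleton ℝ (f (φ t x))) (f₂ := M)
      (Eventually.of_forall fun v => (h1 v.2 v.1).hasFDerivAt)
      (by filter_upwards [hU] with v hv using hM v.1 hv.1 v.2 hv.2)
      (hDc.continuousAt hU) (hMc.continuousAt hU)).hasFDerivAt

/-- The flow of a `C¹` vector field is `C¹` jointly in time and space. -/
theorem contDiff_flow (hf : ContDiff ℝ 1 f) (h0 : ∀ x, φ 0 x = x)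
    (h1 : ∀ x t, HasDerivAt (fun t => φ t x) (f (φ t x)) t) :
    ContDiff ℝ 1 (fun q : ℝ × E => φ q.1 q.2) := by
  refine contDiff_iff_contDiffAt.2 fun ⟨t, x⟩ => ?_
  -- For `s`, `u` near `t`, write `φ_u = φ_{u-s} ∘ φ_s`; the outer factor is covered by the case of
  -- time near `0` at the point `φ_t x`. Hence the times of smoothness along the orbit of `x` form a
  -- clopen set.
  have key : ∀ t, ∃ δ > 0, ∀ s ∈ Metric.ball t δ, ∀ u ∈ Metric.ball t δ,
      ContDiffAt ℝ 1 (fun q : ℝ × E => φ q.1 q.2) (s, x) →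
      ContDiffAt ℝ 1 (fun q : ℝ × E => φ q.1 q.2) (u, x) := by
    intro t
    have h2 := (contDiffAt_flow_zero hf h0 h1 (φ t x)).eventually (by simp)
    have hc : ContinuousAt (fun v : ℝ × ℝ => (v.2 - v.1, φ v.1 x)) (t, t) := by
      have h3 : ContinuousAt (fun v : ℝ × ℝ => φ v.1 x) (t, t) :=
        ContinuousAt.comp (f := Prod.fst) (g := fun t => φ t x) (x := (t, t))
          (h1 x t).continuousAt continuousAt_fst
      exact (continuousAt_snd.sub continuousAt_fst).prodMk h3
    have hc' := hc.eventually (p := fun w => ContDiffAt ℝ 1 (fun q : ℝ × E => φ q.1 q.2) w)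
      (by simpa using h2)
    obtain ⟨δ, hδ, hb⟩ := Metric.eventually_nhds_iff_ball.1 hc'
    refine ⟨δ, hδ, fun s hs u hu hsx => ?_⟩
    have h4 := hb (s, u) (by rw [← ball_prod_same]; exact ⟨hs, hu⟩)
    have h5 : (fun q : ℝ × E => φ q.1 q.2) =
        (fun q : ℝ × E => φ q.1 q.2) ∘ fun q : ℝ × E => (q.1 - s, φ s q.2) := by
      ext q
      simp only [Function.comp_apply]
      rw [← flow_add hf h0 h1, sub_add_cancel]
    rw [h5]
    refine ContDiffAt.comp (u, x) h4 ((contDiffAt_fst.sub contDiffAt_const).prodMk ?_)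
    exact ContDiffAt.comp (u, x) (g := fun q : ℝ × E => φ q.1 q.2)
      (f := fun q : ℝ × E => (s, q.2)) hsx (contDiffAt_const.prodMk contDiffAt_snd)
  have hclopen : IsClopen {t | ContDiffAt ℝ 1 (fun q : ℝ × E => φ q.1 q.2) (t, x)} := by
    constructor
    · refine ⟨Metric.isOpen_iff.2 fun t ht => ?_⟩
      obtain ⟨δ, hδ, h⟩ := key t
      exact ⟨δ, hδ, fun s hs hsx => ht (h s hs t (Metric.mem_ball_self hδ) hsx)⟩
    · refine Metric.isOpen_iff.2 fun t ht => ?_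
      obtain ⟨δ, hδ, h⟩ := key t
      exact ⟨δ, hδ, fun s hs => h t (Metric.mem_ball_self hδ) s hs ht⟩
  have huniv := hclopen.eq_univ ⟨0, contDiffAt_flow_zero hf h0 h1 x⟩
  exact (huniv ▸ mem_univ t : t ∈ {t | ContDiffAt ℝ 1 (fun q : ℝ × E => φ q.1 q.2) (t, x)})

end SmoothFlow

/-! ### Survival in `X` and duality of the transfer operators. -/

section Flow

variable {n : ℕ} {f : EuclideanSpace ℝ (Fin n) → EuclideanSpace ℝ (Fin n)}
  {φ : ℝ → EuclideanSpace ℝ (Fin n) → EuclideanSpace ℝ (Fin n)}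
  {X B : Set (EuclideanSpace ℝ (Fin n))}

theorem IsFlow.hasDerivAt (hφ : IsFlow f φ) (x : EuclideanSpace ℝ (Fin n)) (t : ℝ) :
    HasDerivAt (fun t => φ t x) (f (φ t x)) t := hφ.integralCurve x t

theorem IsFlow.add (hφ : IsFlow f φ) (hf : ContDiff ℝ 1 f) (s t : ℝ)
    (x : EuclideanSpace ℝ (Fin n)) : φ (s + t) x = φ s (φ t x) :=
  flow_add hf hφ.zero hφ.hasDerivAt s t x

theorem IsFlow.neg_apply (hφ : IsFlow f φ) (hf : ContDiff ℝ 1 f) (t : ℝ)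
    (x : EuclideanSpace ℝ (Fin n)) : φ (-t) (φ t x) = x := by
  rw [← hφ.add hf, neg_add_cancel, hφ.zero]

theorem IsFlow.apply_neg (hφ : IsFlow f φ) (hf : ContDiff ℝ 1 f) (t : ℝ)
    (x : EuclideanSpace ℝ (Fin n)) : φ t (φ (-t) x) = x := by
  rw [← hφ.add hf, add_neg_cancel, hφ.zero]

theorem IsFlow.contDiff (hφ : IsFlow f φ) (hf : ContDiff ℝ 1 f) :
    ContDiff ℝ 1 (fun q : ℝ × EuclideanSpace ℝ (Fin n) => φ q.1 q.2) :=
  contDiff_flow hf hφ.zero hφ.hasDerivAt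

theorem IsFlow.continuous (hφ : IsFlow f φ) (hf : ContDiff ℝ 1 f) :
    Continuous (fun q : ℝ × EuclideanSpace ℝ (Fin n) => φ q.1 q.2) := (hφ.contDiff hf).continuous

theorem IsFlow.continuous_apply (hφ : IsFlow f φ) (hf : ContDiff ℝ 1 f) (t : ℝ) :
    Continuous (φ t) := (hφ.continuous hf).comp (Continuous.prodMk_right t)

theorem IsFlow.continuous_time (hφ : IsFlow f φ) (x : EuclideanSpace ℝ (Fin n)) :
    Continuous (fun t => φ t x) := (hφ.integralCurve x).continuous

theorem IsFlow.contDiff_apply (hφ : IsFlow f φ) (hf : ContDiff ℝ 1 f) (t : ℝ) :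
    ContDiff ℝ 1 (φ t) := (hφ.contDiff hf).comp (contDiff_prodMk_right t)

theorem IsFlow.differentiable (hφ : IsFlow f φ) (hf : ContDiff ℝ 1 f) (t : ℝ) :
    Differentiable ℝ (φ t) := (hφ.contDiff_apply hf t).differentiable one_ne_zero

theorem IsFlow.continuous_fderiv (hφ : IsFlow f φ) (hf : ContDiff ℝ 1 f) :
    Continuous (fun q : ℝ × EuclideanSpace ℝ (Fin n) => fderiv ℝ (φ q.1) q.2) := by
  have h := (hφ.contDiff hf).continuous_fderiv one_ne_zero
  have e : (fun q : ℝ × EuclideanSpace ℝ (Fin n) => fderiv ℝ (φ q.1) q.2) = fun q =>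
      (fderiv ℝ (fun q : ℝ × EuclideanSpace ℝ (Fin n) => φ q.1 q.2) q).comp
        (ContinuousLinearMap.inr ℝ ℝ (EuclideanSpace ℝ (Fin n))) := by
    ext1 q
    have h2 := ((hφ.contDiff hf).differentiable one_ne_zero q).hasFDerivAt
    exact (HasFDerivAt.comp (f := fun y => (q.1, y)) q.2 h2
      (hasFDerivAt_prodMk_right q.1 q.2)).fderiv
  rw [e]
  exact h.clm_comp continuous_const

theorem IsFlow.injective (hφ : IsFlow f φ) (hf : ContDiff ℝ 1 f) (t : ℝ) :
    Function.Injective (φ t) := Function.LeftInverse.injective (hφ.neg_apply hf t)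

theorem IsFlow.surjective (hφ : IsFlow f φ) (hf : ContDiff ℝ 1 f) (t : ℝ) :
    Function.Surjective (φ t) := Function.RightInverse.surjective (hφ.apply_neg hf t)

theorem IsFlow.det_fderiv_ne_zero (hφ : IsFlow f φ) (hf : ContDiff ℝ 1 f) (t : ℝ)
    (x : EuclideanSpace ℝ (Fin n)) : (fderiv ℝ (φ t) x).det ≠ 0 := by
  have h1 := (hφ.differentiable hf t x).hasFDerivAt
  have h2 := (hφ.differentiable hf (-t) (φ t x)).hasFDerivAt
  have h3 := h2.comp x h1
  have h4 : φ (-t) ∘ φ t = id := funext (hφ.neg_apply hf t)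
  rw [h4] at h3
  have h5 := h3.unique (hasFDerivAt_id x)
  intro h7
  have h8 : (fderiv ℝ (φ (-t)) (φ t x)).det * (fderiv ℝ (φ t) x).det = 1 := by
    have h9 : ((fderiv ℝ (φ (-t)) (φ t x)).comp (fderiv ℝ (φ t) x)).det =
        (fderiv ℝ (φ (-t)) (φ t x)).det * (fderiv ℝ (φ t) x).det :=
      LinearMap.det_comp _ _
    rw [← h9, h5]
    exact LinearMap.det_id
  rw [h7, mul_zero] at h8
  exact zero_ne_one h8

/-- Rescaling to the fixed compact interval `[0,1]` reduces the openness of survival to a tube-lemma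
argument. -/
theorem alive_iff {t : ℝ} {x : EuclideanSpace ℝ (Fin n)} :
    Alive φ X t x ↔ ∀ θ ∈ Icc (0 : ℝ) 1, φ (θ * t) x ∈ interior X := by
  constructor
  · intro h θ hθ
    refine h _ (mem_uIcc.2 ?_)
    rcases le_total 0 t with ht | ht
    · exact Or.inl ⟨mul_nonneg hθ.1 ht, mul_le_of_le_one_left ht hθ.2⟩
    · exact Or.inr ⟨by nlinarith [hθ.1, hθ.2], by nlinarith [hθ.1, hθ.2]⟩
  · intro h s hs
    by_cases ht : t = 0
    · subst ht
      have hs0 : s = 0 := by simpa using hs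
      simpa [hs0] using h 0 ⟨le_rfl, zero_le_one⟩
    · have h2 := h (s / t) ?_
      · rwa [div_mul_cancel₀ s ht] at h2
      · rcases mem_uIcc.1 hs with hs | hs
        · exact ⟨div_nonneg hs.1 (hs.1.trans hs.2), div_le_one_of_le₀ hs.2 (hs.1.trans hs.2)⟩
        · refine ⟨div_nonneg_of_nonpos hs.2 (hs.1.trans hs.2), ?_⟩
          rw [div_le_one_of_neg (lt_of_le_of_ne (hs.1.trans hs.2) ht)]
          exact hs.1

theorem Alive.mem_interior (hφ : IsFlow f φ) {t : ℝ} {x : EuclideanSpace ℝ (Fin n)}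
    (h : Alive φ X t x) : x ∈ interior X := by
  simpa [hφ.zero] using h 0 left_mem_uIcc

theorem isOpen_alive (hφ : IsFlow f φ) (hf : ContDiff ℝ 1 f) :
    IsOpen {q : ℝ × EuclideanSpace ℝ (Fin n) | Alive φ X q.1 q.2} := by
  rw [isOpen_iff_mem_nhds]
  intro q hq
  have hc : Continuous fun z : (ℝ × EuclideanSpace ℝ (Fin n)) × ℝ => φ (z.2 * z.1.1) z.1.2 :=
    (hφ.continuous hf).comp (by fun_prop : Continuous fun z :
      (ℝ × EuclideanSpace ℝ (Fin n)) × ℝ => (z.2 * z.1.1, z.1.2))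
  have h := (isCompact_Icc (a := (0 : ℝ)) (b := 1)).eventually_forall_of_forall_eventually
    (x₀ := q) (P := fun q θ => φ (θ * q.1) q.2 ∈ interior X) fun θ hθ =>
      hc.continuousAt.eventually (isOpen_interior.mem_nhds (alive_iff.1 hq θ hθ))
  filter_upwards [h] with q' hq'
  exact alive_iff.2 hq'

theorem alive_neg_apply (hφ : IsFlow f φ) (hf : ContDiff ℝ 1 f) {t : ℝ}
    {x : EuclideanSpace ℝ (Fin n)} : Alive φ X (-t) (φ t x) ↔ Alive φ X t x := by
  constructor
  · intro h s hs
    have h2 := h (s - t) ?_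
    · rwa [← hφ.add hf, sub_add_cancel] at h2
    · rw [mem_uIcc] at *
      grind
  · intro h s hs
    rw [← hφ.add hf]
    refine h _ ?_
    rw [mem_uIcc] at *
    grind

theorem measurableSet_alive (hφ : IsFlow f φ) (hf : ContDiff ℝ 1 f) :
    MeasurableSet {q : ℝ × EuclideanSpace ℝ (Fin n) | Alive φ X q.1 q.2} :=
  (isOpen_alive hφ hf).measurableSet

theorem perronFrobenius_nonneg {ρ : EuclideanSpace ℝ (Fin n) → ℝ} (hρ : ∀ x, 0 ≤ ρ x) (t : ℝ)
    (x : EuclideanSpace ℝ (Fin n)) : 0 ≤ perronFrobenius φ X t ρ x := by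
  unfold perronFrobenius
  split_ifs
  · exact mul_nonneg (hρ _) (inv_nonneg.2 (abs_nonneg _))
  · exact le_rfl

theorem measurable_perronFrobenius (hφ : IsFlow f φ) (hf : ContDiff ℝ 1 f)
    {ρ : EuclideanSpace ℝ (Fin n) → ℝ} (hρ : Measurable ρ) :
    Measurable fun q : ℝ × EuclideanSpace ℝ (Fin n) => perronFrobenius φ X q.1 ρ q.2 := by
  have hneg : Continuous fun q : ℝ × EuclideanSpace ℝ (Fin n) => (-q.1, q.2) := by fun_prop
  have hback : Continuous fun q : ℝ × EuclideanSpace ℝ (Fin n) => φ (-q.1) q.2 :=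
    (hφ.continuous hf).comp hneg
  have hdet : Continuous fun q : ℝ × EuclideanSpace ℝ (Fin n) =>
      |(fderiv ℝ (φ q.1) (φ (-q.1) q.2)).det| :=
    (ContinuousLinearMap.continuous_det.comp
      ((hφ.continuous_fderiv hf).comp (continuous_fst.prodMk hback))).abs
  refine Measurable.ite ?_ ((hρ.comp hback.measurable).mul hdet.measurable.inv) measurable_const
  exact (measurableSet_alive hφ hf).preimage hneg.measurable

theorem perronFrobenius_apply_of_alive (hφ : IsFlow f φ) (hf : ContDiff ℝ 1 f) {t : ℝ}
    {y : EuclideanSpace ℝ (Fin n)} (h : Alive φ X t y) (ρ : EuclideanSpace ℝ (Fin n) → ℝ) :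
    perronFrobenius φ X t ρ (φ t y) = ρ y * |(fderiv ℝ (φ t) y).det|⁻¹ := by
  rw [perronFrobenius, if_pos ((alive_neg_apply hφ hf).2 h), hφ.neg_apply hf]

theorem perronFrobenius_apply_of_not_alive (hφ : IsFlow f φ) (hf : ContDiff ℝ 1 f) {t : ℝ}
    {y : EuclideanSpace ℝ (Fin n)} (h : ¬Alive φ X t y) (ρ : EuclideanSpace ℝ (Fin n) → ℝ) :
    perronFrobenius φ X t ρ (φ t y) = 0 := by
  rw [perronFrobenius, if_neg fun h' => h ((alive_neg_apply hφ hf).1 h')]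

/-- `P_t` is dual to composition with the flow. -/
theorem lintegral_perronFrobenius_mul (hφ : IsFlow f φ) (hf : ContDiff ℝ 1 f)
    (hB : MeasurableSet B) (t : ℝ) (g : EuclideanSpace ℝ (Fin n) → ENNReal) :
    ∫⁻ x, ENNReal.ofReal (perronFrobenius φ X t (B.indicator 1) x) * g x =
      ∫⁻ y in {y | y ∈ B ∧ Alive φ X t y}, g (φ t y) := by
  -- The Jacobian of the substitution `x = φ_t(y)` cancels the inverse determinant in `P_t`.
  have h := lintegral_image_eq_lintegral_abs_det_fderiv_mul volume MeasurableSet.univ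
    (fun x _ => (hφ.differentiable hf t x).hasFDerivAt.hasFDerivWithinAt)
    (hφ.injective hf t).injOn
    (fun x => ENNReal.ofReal (perronFrobenius φ X t (B.indicator 1) x) * g x)
  rw [image_univ, (hφ.surjective hf t).range_eq, setLIntegral_univ, setLIntegral_univ] at h
  rw [h]
  have hA : MeasurableSet {y | y ∈ B ∧ Alive φ X t y} :=
    hB.inter ((measurableSet_alive hφ hf).preimage measurable_prodMk_left)
  rw [← lintegral_indicator hA]
  refine lintegral_congr fun y => ?_
  have hd : 0 < |(fderiv ℝ (φ t) y).det| := abs_pos.2 (hφ.det_fderiv_ne_zero hf t y)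
  by_cases h2 : Alive φ X t y
  · rw [perronFrobenius_apply_of_alive hφ hf h2]
    by_cases h1 : y ∈ B
    · rw [indicator_of_mem h1, indicator_of_mem (show y ∈ {y | y ∈ B ∧ Alive φ X t y} from ⟨h1, h2⟩),
        ← mul_assoc, ← ENNReal.ofReal_mul hd.le, Pi.one_apply, one_mul, mul_inv_cancel₀ hd.ne',
        ENNReal.ofReal_one, one_mul]
    · rw [indicator_of_notMem h1, indicator_of_notMem fun h3 => h1 h3.1]
      simp
  · rw [perronFrobenius_apply_of_not_alive hφ hf h2, indicator_of_notMem fun h3 => h2 h3.2]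
    simp

end Flow

/-! ### The occupation density and its finiteness away from the equilibrium. -/

noncomputable section Density

variable {n : ℕ} {f : EuclideanSpace ℝ (Fin n) → EuclideanSpace ℝ (Fin n)}
  {φ : ℝ → EuclideanSpace ℝ (Fin n) → EuclideanSpace ℝ (Fin n)}
  {X B : Set (EuclideanSpace ℝ (Fin n))}

/-- The extended nonnegative density `∫_I P_t χ_B dt`. -/
def rhoOn (φ : ℝ → EuclideanSpace ℝ (Fin n) → EuclideanSpace ℝ (Fin n))
    (X B : Set (EuclideanSpace ℝ (Fin n))) (I : Set ℝ) (x : EuclideanSpace ℝ (Fin n)) : ENNReal :=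
  ∫⁻ t in I, ENNReal.ofReal (perronFrobenius φ X t (B.indicator 1) x)

theorem measurable_perronFrobenius_indicator (hφ : IsFlow f φ) (hf : ContDiff ℝ 1 f)
    (hB : MeasurableSet B) : Measurable fun q : ℝ × EuclideanSpace ℝ (Fin n) =>
      perronFrobenius φ X q.1 (B.indicator 1) q.2 :=
  measurable_perronFrobenius hφ hf (measurable_one.indicator hB)

theorem perronFrobenius_indicator_nonneg (t : ℝ) (x : EuclideanSpace ℝ (Fin n)) :
    0 ≤ perronFrobenius φ X t (B.indicator 1) x :=
  perronFrobenius_nonneg (fun _ => indicator_nonneg (fun _ _ => zero_le_one) _) t x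

theorem measurable_rhoOn (hφ : IsFlow f φ) (hf : ContDiff ℝ 1 f) (hB : MeasurableSet B)
    (I : Set ℝ) : Measurable (rhoOn φ X B I) :=
  ((measurable_perronFrobenius_indicator hφ hf hB).comp
    measurable_swap).ennreal_ofReal.lintegral_prod_right'

theorem lintegral_rhoOn_mul (hφ : IsFlow f φ) (hf : ContDiff ℝ 1 f) (hB : MeasurableSet B)
    (I : Set ℝ) {g : EuclideanSpace ℝ (Fin n) → ENNReal} (hg : Measurable g) :
    ∫⁻ x, rhoOn φ X B I x * g x =
      ∫⁻ t in I, ∫⁻ y in {y | y ∈ B ∧ Alive φ X t y}, g (φ t y) := by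
  have hm : Measurable fun q : ℝ × EuclideanSpace ℝ (Fin n) =>
      ENNReal.ofReal (perronFrobenius φ X q.1 (B.indicator 1) q.2) :=
    (measurable_perronFrobenius_indicator hφ hf hB).ennreal_ofReal
  calc ∫⁻ x, rhoOn φ X B I x * g x
      = ∫⁻ x, ∫⁻ t in I, ENNReal.ofReal (perronFrobenius φ X t (B.indicator 1) x) * g x :=
        lintegral_congr fun x => (lintegral_mul_const _ (hm.comp measurable_prodMk_right)).symm
    _ = ∫⁻ t in I, ∫⁻ x, ENNReal.ofReal (perronFrobenius φ X t (B.indicator 1) x) * g x :=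
        lintegral_lintegral_swap
          ((hm.comp measurable_swap).mul (hg.comp measurable_fst)).aemeasurable
    _ = _ := lintegral_congr fun t => lintegral_perronFrobenius_mul hφ hf hB t g

/-- The pairs `(t, y)` for which the trajectory that starts at `y ∈ B` is alive at time `t`. -/
def aliveFrom (φ : ℝ → EuclideanSpace ℝ (Fin n) → EuclideanSpace ℝ (Fin n))
    (X B : Set (EuclideanSpace ℝ (Fin n))) : Set (ℝ × EuclideanSpace ℝ (Fin n)) :=
  {q | q.2 ∈ B ∧ Alive φ X q.1 q.2}

theorem measurableSet_aliveFrom (hφ : IsFlow f φ) (hf : ContDiff ℝ 1 f) (hB : MeasurableSet B) :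
    MeasurableSet (aliveFrom φ X B) :=
  (measurable_snd hB).inter (measurableSet_alive hφ hf)

/-- This is Tonelli together with duality, tested on indicators. It converts integrals against the
density into integrals along orbits. -/
theorem withDensity_rhoOn (hφ : IsFlow f φ) (hf : ContDiff ℝ 1 f) (hB : MeasurableSet B)
    (I : Set ℝ) : (volume : Measure (EuclideanSpace ℝ (Fin n))).withDensity (rhoOn φ X B I) =
      ((((volume : Measure ℝ).restrict I).prod volume).restrict (aliveFrom φ X B)).map
        (fun q => φ q.1 q.2) := by
  have hS := measurableSet_aliveFrom (X := X) hφ hf hB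
  have hmφ := (hφ.continuous hf).measurable
  refine Measure.ext fun A hA => ?_
  have h := lintegral_rhoOn_mul (X := X) hφ hf hB I (measurable_one.indicator hA)
  rw [withDensity_apply _ hA, Measure.map_apply hmφ hA, Measure.restrict_apply (hmφ hA),
    Measure.prod_apply ((hmφ hA).inter hS), ← lintegral_indicator hA]
  calc ∫⁻ x, A.indicator (rhoOn φ X B I) x
      = ∫⁻ x, rhoOn φ X B I x * A.indicator 1 x := lintegral_congr fun x => by
        by_cases hx : x ∈ A <;> simp [hx]
    _ = _ := h.trans (lintegral_congr fun t => ?_)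
  have h2 : (fun y => (A.indicator 1 (φ t y) : ENNReal)) = (φ t ⁻¹' A).indicator 1 := rfl
  rw [h2, lintegral_indicator_one ((hφ.continuous_apply hf t).measurable hA),
    Measure.restrict_apply ((hφ.continuous_apply hf t).measurable hA)]
  rfl

theorem perronFrobenius_eq_zero_of_notMem (hφ : IsFlow f φ) {t : ℝ}
    {ρ : EuclideanSpace ℝ (Fin n) → ℝ} {x : EuclideanSpace ℝ (Fin n)} (hx : x ∉ interior X) :
    perronFrobenius φ X t ρ x = 0 :=
  if_neg fun h => hx (h.mem_interior hφ)

theorem rhoOn_eq_zero_of_notMem (hφ : IsFlow f φ) {I : Set ℝ} {x : EuclideanSpace ℝ (Fin n)}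
    (hx : x ∉ interior X) : rhoOn φ X B I x = 0 := by
  simp [rhoOn, perronFrobenius_eq_zero_of_notMem hφ hx]

/-- Split time at the `T` that stability provides for `ε = 1`: the part up to `T` contributes at
most `T * m(X)`, the tail less than `1`. -/
theorem setLIntegral_rhoOn_lt_top (hφ : IsFlow f φ) (hf : ContDiff ℝ 1 f) (hB : MeasurableSet B)
    (hBX : B ⊆ X) (hX : IsCompact X) (hstab : AEUniformlyStable f φ X) {δ : ℝ} (hδ : 0 < δ) :
    ∫⁻ x in X \ Metric.ball 0 δ, rhoOn φ X B (Ioi 0) x < ⊤ := by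
  obtain ⟨T, hT, h⟩ := hstab.2 δ hδ 1 one_pos
  have hA : MeasurableSet (X \ Metric.ball 0 δ) := hX.measurableSet.diff measurableSet_ball
  have h2 := lintegral_rhoOn_mul (X := X) hφ hf hB (Ioi 0) (measurable_one.indicator hA)
  have h3 : ∫⁻ x in X \ Metric.ball 0 δ, rhoOn φ X B (Ioi 0) x =
      ∫⁻ x, rhoOn φ X B (Ioi 0) x * (X \ Metric.ball 0 δ).indicator 1 x := by
    rw [← lintegral_indicator hA]
    exact lintegral_congr fun x => by by_cases hx : x ∈ X \ Metric.ball 0 δ <;> simp [hx]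
  rw [h3, h2, ← Ioc_union_Ioi_eq_Ioi hT]
  refine (lintegral_union_le _ _ _).trans_lt (ENNReal.add_lt_top.2 ⟨?_, ?_⟩)
  · calc _ ≤ ∫⁻ _ in Ioc 0 T, volume X := lintegral_mono fun t => by
          calc _ ≤ ∫⁻ y in {y | y ∈ B ∧ Alive φ X t y}, 1 :=
                lintegral_mono fun y => indicator_le' (g := 1) (by simp) (by simp) (φ t y)
            _ ≤ volume X := by
                rw [setLIntegral_one]
                exact measure_mono fun y hy => hBX hy.1
      _ < ⊤ := by
          rw [setLIntegral_const]
          exact ENNReal.mul_lt_top hX.measure_lt_top (by simp)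
  · refine lt_of_le_of_lt (lintegral_mono fun t => ?_) ((h _ hA le_rfl).trans ENNReal.ofReal_lt_top)
    have h4 := (hφ.continuous_apply hf t).measurable hA
    calc _ = ∫⁻ y in {y | y ∈ B ∧ Alive φ X t y}, (φ t ⁻¹' (X \ Metric.ball 0 δ)).indicator 1 y :=
          rfl
      _ ≤ _ := by
        rw [lintegral_indicator_one h4, Measure.restrict_apply h4]
        exact measure_mono fun y hy => ⟨hBX hy.2.1, hy.2.2, hy.1⟩

theorem ae_rhoOn_lt_top (hn : 1 ≤ n) (hφ : IsFlow f φ) (hf : ContDiff ℝ 1 f) (hB : MeasurableSet B)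
    (hBX : B ⊆ X) (hX : IsCompact X) (hstab : AEUniformlyStable f φ X) :
    ∀ᵐ x, rhoOn φ X B (Ioi 0) x < ⊤ := by
  have : Nonempty (Fin n) := ⟨⟨0, hn⟩⟩
  have h1 : ∀ᵐ x : EuclideanSpace ℝ (Fin n), x ≠ 0 := by simp [ae_iff]
  have h2 : ∀ k : ℕ, ∀ᵐ x, x ∈ X \ Metric.ball 0 (1 / ((k : ℝ) + 1)) →
      rhoOn φ X B (Ioi 0) x < ⊤ := fun k => by
    have hA : MeasurableSet (X \ Metric.ball 0 (1 / ((k : ℝ) + 1))) :=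
      hX.measurableSet.diff measurableSet_ball
    exact (ae_restrict_iff' hA).1 (ae_lt_top (measurable_rhoOn hφ hf hB _)
      (setLIntegral_rhoOn_lt_top hφ hf hB hBX hX hstab (by positivity)).ne)
  filter_upwards [h1, ae_all_iff.2 h2] with x hx hk
  by_cases hxX : x ∈ X
  · obtain ⟨k, hk'⟩ := exists_nat_one_div_lt (norm_pos_iff.2 hx)
    exact hk k ⟨hxX, by simpa using hk'.le⟩
  · rw [rhoOn_eq_zero_of_notMem hφ fun h => hxX (interior_subset h)]
    exact ENNReal.zero_lt_top

/-- Valid even where the integral diverges: there the Bochner integral and `ENNReal.toReal ⊤` are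
both `0` by convention. -/
theorem rhoB_eq_toReal (hφ : IsFlow f φ) (hf : ContDiff ℝ 1 f) (hB : MeasurableSet B)
    (x : EuclideanSpace ℝ (Fin n)) : rhoB φ X B x = (rhoOn φ X B (Ioi 0) x).toReal :=
  integral_eq_lintegral_of_nonneg_ae
    (Eventually.of_forall fun t => perronFrobenius_indicator_nonneg t x)
    ((measurable_perronFrobenius_indicator hφ hf hB).comp
      measurable_prodMk_right).aestronglyMeasurable

theorem integrableOn_perronFrobenius (hφ : IsFlow f φ) (hf : ContDiff ℝ 1 f) (hB : MeasurableSet B)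
    {x : EuclideanSpace ℝ (Fin n)} (hx : rhoOn φ X B (Ioi 0) x < ⊤) :
    IntegrableOn (fun t => perronFrobenius φ X t (B.indicator 1) x) (Ioi 0) := by
  refine ⟨((measurable_perronFrobenius_indicator hφ hf hB).comp
    measurable_prodMk_right).aestronglyMeasurable, ?_⟩
  rw [hasFiniteIntegral_iff_ofReal
    (Eventually.of_forall fun t => perronFrobenius_indicator_nonneg t x)]
  exact hx

theorem measurable_rhoB (hφ : IsFlow f φ) (hf : ContDiff ℝ 1 f) (hB : MeasurableSet B) :
    Measurable (rhoB φ X B) := by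
  rw [funext (rhoB_eq_toReal hφ hf hB)]
  exact (measurable_rhoOn hφ hf hB _).ennreal_toReal

theorem rhoB_nonneg (x : EuclideanSpace ℝ (Fin n)) : 0 ≤ rhoB φ X B x :=
  integral_nonneg fun t => perronFrobenius_indicator_nonneg t x

end Density

/-! ### The gramian as a multiplication operator. -/

section Gramian

theorem tendsto_eLpNorm_two_of_dominated {α ι : Type*} [MeasurableSpace α] {μ : Measure α}
    {l : Filter ι} [l.IsCountablyGenerated] {F : ι → α → ℝ} {g : α → ℝ}
    (hF : ∀ᶠ i in l, AEStronglyMeasurable (F i) μ) (hg : MemLp g 2 μ)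
    (hle : ∀ᶠ i in l, ∀ᵐ a ∂μ, ‖F i a‖ ≤ ‖g a‖)
    (hlim : ∀ᵐ a ∂μ, Tendsto (fun i => F i a) l (𝓝 0)) :
    Tendsto (fun i => eLpNorm (F i) 2 μ) l (𝓝 0) := by
  have h2 : ∀ h : α → ℝ, eLpNorm h 2 μ = (∫⁻ a, ‖h a‖ₑ ^ (2 : ℝ) ∂μ) ^ (1 / 2 : ℝ) := fun h => by
    rw [eLpNorm_eq_lintegral_rpow_enorm_toReal two_ne_zero ENNReal.ofNat_ne_top]
    simp
  have hfin : ∫⁻ a, ‖g a‖ₑ ^ (2 : ℝ) ∂μ ≠ ⊤ := by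
    have := hg.2.ne
    rw [h2] at this
    intro h
    rw [h] at this
    simp at this
  have key : Tendsto (fun i => ∫⁻ a, ‖F i a‖ₑ ^ (2 : ℝ) ∂μ) l (𝓝 (∫⁻ _, 0 ∂μ)) := by
    refine tendsto_lintegral_filter_of_dominated_convergence' (fun a => ‖g a‖ₑ ^ (2 : ℝ)) ?_ ?_
      hfin ?_
    · filter_upwards [hF] with i hi using hi.enorm.pow_const _
    · filter_upwards [hle] with i hi
      filter_upwards [hi] with a ha
      exact ENNReal.rpow_le_rpow (enorm_le_iff_norm_le.2 ha) (by norm_num)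
    · filter_upwards [hlim] with a ha
      have h3 := (ENNReal.continuous_rpow_const (y := 2)).continuousAt.tendsto.comp ha.enorm
      simpa [Function.comp_def] using h3
  have h4 := (ENNReal.continuous_rpow_const (y := 1 / 2)).continuousAt.tendsto.comp key
  simp only [lintegral_zero] at h4
  rw [ENNReal.zero_rpow_of_pos (by norm_num)] at h4
  exact h4.congr fun i => (h2 (F i)).symm

variable {n : ℕ} {f : EuclideanSpace ℝ (Fin n) → EuclideanSpace ℝ (Fin n)}
  {φ : ℝ → EuclideanSpace ℝ (Fin n) → EuclideanSpace ℝ (Fin n)}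
  {X B : Set (EuclideanSpace ℝ (Fin n))}

/-- Going back along the flow and then forward returns to `x`, so `z x` factors out. One indicator
comes from the controllability operator, the other from its adjoint. -/
theorem perronFrobenius_indicator_koopman (hφ : IsFlow f φ) (hf : ContDiff ℝ 1 f) (t : ℝ)
    (z : EuclideanSpace ℝ (Fin n) → ℝ) (x : EuclideanSpace ℝ (Fin n)) :
    perronFrobenius φ X t (B.indicator (B.indicator (koopman φ X t z))) x =
      perronFrobenius φ X t (B.indicator 1) x * z x := by
  obtain ⟨y, rfl⟩ := hφ.surjective hf t x
  by_cases h : Alive φ X t y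
  · rw [perronFrobenius_apply_of_alive hφ hf h, perronFrobenius_apply_of_alive hφ hf h]
    by_cases hy : y ∈ B
    · simp [hy, koopman, h, mul_comm]
    · simp [hy]
  · rw [perronFrobenius_apply_of_not_alive hφ hf h, perronFrobenius_apply_of_not_alive hφ hf h,
      zero_mul]

theorem gramian_eq (hφ : IsFlow f φ) (hf : ContDiff ℝ 1 f) (τ : ℝ)
    (z : EuclideanSpace ℝ (Fin n) → ℝ) (x : EuclideanSpace ℝ (Fin n)) :
    gramian φ X B τ z x =
      (∫ t in (0 : ℝ)..τ, perronFrobenius φ X t (B.indicator 1) x) * z x := by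
  have h := intervalIntegral.integral_comp_sub_left (a := 0) (b := τ)
    (fun t => perronFrobenius φ X t (B.indicator (B.indicator (koopman φ X t z))) x) τ
  rw [sub_self, sub_zero] at h
  refine Eq.trans h ?_
  simp only [perronFrobenius_indicator_koopman hφ hf]
  rw [intervalIntegral.integral_mul_const]

theorem tendsto_gramian (hφ : IsFlow f φ) (hf : ContDiff ℝ 1 f) (hB : MeasurableSet B)
    (z : EuclideanSpace ℝ (Fin n) → ℝ) {x : EuclideanSpace ℝ (Fin n)}
    (hx : rhoOn φ X B (Ioi 0) x < ⊤) :
    Tendsto (fun τ => gramian φ X B τ z x) atTop (𝓝 (rhoB φ X B x * z x)) := by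
  simp only [gramian_eq hφ hf]
  exact (intervalIntegral_tendsto_integral_Ioi 0 (integrableOn_perronFrobenius hφ hf hB hx)
    tendsto_id).mul_const _

/-- The truncated time integral lies between `0` and `ρ_B`, so the limit itself dominates the error;
no further integrability is needed on the domain. -/
theorem norm_gramian_sub_le (hφ : IsFlow f φ) (hf : ContDiff ℝ 1 f) (hB : MeasurableSet B)
    (z : EuclideanSpace ℝ (Fin n) → ℝ) {x : EuclideanSpace ℝ (Fin n)}
    (hx : rhoOn φ X B (Ioi 0) x < ⊤) {τ : ℝ} (hτ : 0 ≤ τ) :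
    ‖gramian φ X B τ z x - rhoB φ X B x * z x‖ ≤ ‖rhoB φ X B x * z x‖ := by
  have h1 : 0 ≤ ∫ t in (0 : ℝ)..τ, perronFrobenius φ X t (B.indicator 1) x :=
    intervalIntegral.integral_nonneg hτ fun t _ => perronFrobenius_indicator_nonneg t x
  have h2 : ∫ t in (0 : ℝ)..τ, perronFrobenius φ X t (B.indicator 1) x ≤ rhoB φ X B x := by
    rw [intervalIntegral.integral_of_le hτ]
    exact setIntegral_mono_set (integrableOn_perronFrobenius hφ hf hB hx)
      (Eventually.of_forall fun t => perronFrobenius_indicator_nonneg t x)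
      (Eventually.of_forall Ioc_subset_Ioi_self)
  rw [gramian_eq hφ hf, ← sub_mul, norm_mul, norm_mul]
  refine mul_le_mul_of_nonneg_right ?_ (norm_nonneg _)
  rw [Real.norm_of_nonneg (rhoB_nonneg x), Real.norm_eq_abs, abs_le]
  constructor <;> linarith

theorem aestronglyMeasurable_gramian (hφ : IsFlow f φ) (hf : ContDiff ℝ 1 f)
    (hB : MeasurableSet B) {μ : Measure (EuclideanSpace ℝ (Fin n))}
    {z : EuclideanSpace ℝ (Fin n) → ℝ} (hz : AEStronglyMeasurable z μ) (τ : ℝ) :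
    AEStronglyMeasurable (gramian φ X B τ z) μ := by
  rw [funext (gramian_eq hφ hf τ z)]
  refine AEStronglyMeasurable.mul ?_ hz
  have hm : StronglyMeasurable fun q : EuclideanSpace ℝ (Fin n) × ℝ =>
      perronFrobenius φ X q.2 (B.indicator 1) q.1 :=
    ((measurable_perronFrobenius_indicator hφ hf hB).comp measurable_swap).stronglyMeasurable
  simp only [intervalIntegral]
  exact (hm.integral_prod_right'.sub hm.integral_prod_right').aestronglyMeasurable

theorem mem_infiniteGramianGraph_iff (hφ : IsFlow f φ) (hf : ContDiff ℝ 1 f)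
    (hB : MeasurableSet B) (hfin : ∀ᵐ x, rhoOn φ X B (Ioi 0) x < ⊤)
    (z w : Lp ℝ 2 ((volume : Measure (EuclideanSpace ℝ (Fin n))).restrict X)) :
    (z, w) ∈ infiniteGramianGraph φ X B ↔
      w =ᵐ[volume.restrict X] fun x => rhoB φ X B x * z x := by
  have hfin' := ae_restrict_of_ae (s := X) hfin
  have hgm := fun τ => aestronglyMeasurable_gramian (X := X) hφ hf hB (Lp.aestronglyMeasurable z) τ
  constructor
  · intro h
    -- Convergence in `L²` gives almost everywhere convergence along a sequence of times, whose
    -- limit must be the known pointwise one.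
    have h2 := tendstoInMeasure_of_tendsto_eLpNorm two_ne_zero hgm (Lp.aestronglyMeasurable w) h
    obtain ⟨τ, hτ, h3⟩ := h2.exists_seq_tendsto_ae'
    filter_upwards [h3, hfin'] with x hx hx'
    exact tendsto_nhds_unique hx ((tendsto_gramian hφ hf hB z hx').comp hτ)
  · intro h
    refine tendsto_eLpNorm_two_of_dominated (g := w)
      (Eventually.of_forall fun τ => (hgm τ).sub (Lp.aestronglyMeasurable w)) (Lp.memLp w) ?_ ?_
    · filter_upwards [eventually_ge_atTop 0] with τ hτ
      filter_upwards [h, hfin'] with x hx hx'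
      rw [hx]
      exact norm_gramian_sub_le hφ hf hB z hx' hτ
    · filter_upwards [h, hfin'] with x hx hx'
      rw [hx]
      simpa using (tendsto_gramian hφ hf hB z hx').sub_const (rhoB φ X B x * z x)

/-- Cut `z` off to `{ρ_B ≤ k}`: multiplication by `ρ_B` is bounded there, and the cut-offs converge
to `z` in `L²` because `ρ_B` is real-valued. -/
theorem dense_infiniteGramian_domain (hφ : IsFlow f φ) (hf : ContDiff ℝ 1 f)
    (hB : MeasurableSet B) (hfin : ∀ᵐ x, rhoOn φ X B (Ioi 0) x < ⊤) :
    Dense {z : Lp ℝ 2 ((volume : Measure (EuclideanSpace ℝ (Fin n))).restrict X) |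
      ∃ w, (z, w) ∈ infiniteGramianGraph φ X B} := by
  intro z
  set A : ℕ → Set (EuclideanSpace ℝ (Fin n)) := fun k => {x | rhoB φ X B x ≤ k} with hA
  have hρ : Measurable (rhoB φ X B) := measurable_rhoB hφ hf hB
  have hAm : ∀ k, MeasurableSet (A k) := fun k => measurableSet_le hρ measurable_const
  have hz : ∀ k, MemLp ((A k).indicator z) 2 (volume.restrict X) := fun k =>
    (Lp.memLp z).indicator (hAm k)
  have hw : ∀ k, MemLp (fun x => rhoB φ X B x * (A k).indicator z x) 2 (volume.restrict X) := by
    intro k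
    refine MemLp.of_le_mul (c := k) (hz k)
      (hρ.aestronglyMeasurable.mul (hz k).aestronglyMeasurable)
      (Eventually.of_forall fun x => ?_)
    by_cases hx : x ∈ A k
    · rw [norm_mul, Real.norm_of_nonneg (rhoB_nonneg x)]
      exact mul_le_mul_of_nonneg_right hx (norm_nonneg _)
    · simp [hx]
  refine mem_closure_of_tendsto (f := fun k => (hz k).toLp) (b := atTop) ?_
    (Eventually.of_forall fun k => ⟨(hw k).toLp, ?_⟩)
  · rw [Lp.tendsto_Lp_iff_tendsto_eLpNorm']
    have h1 : Tendsto (fun k => eLpNorm ((A k).indicator z - ⇑z) 2 (volume.restrict X)) atTop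
        (𝓝 0) := by
      refine tendsto_eLpNorm_two_of_dominated (g := z) (Eventually.of_forall fun k =>
        (hz k).aestronglyMeasurable.sub (Lp.aestronglyMeasurable z)) (Lp.memLp z)
        (Eventually.of_forall fun k => Eventually.of_forall fun x => ?_)
        (Eventually.of_forall fun x => ?_)
      · by_cases hx : x ∈ A k <;> simp [hx]
      · obtain ⟨k₀, hk₀⟩ := exists_nat_ge (rhoB φ X B x)
        refine tendsto_const_nhds.congr' ?_
        filter_upwards [eventually_ge_atTop k₀] with k hk
        have hx : x ∈ A k := hk₀.trans (by exact_mod_cast hk)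
        simp [hx]
    refine h1.congr fun k => eLpNorm_congr_ae ?_
    filter_upwards [(hz k).coeFn_toLp] with x hx
    simp [hx]
  · rw [mem_infiniteGramianGraph_iff hφ hf hB hfin]
    filter_upwards [(hz k).coeFn_toLp, (hw k).coeFn_toLp] with x hx hx'
    rw [hx, hx']

end Gramian

/-! ### Positivity through recurrence to `B` in the recent past. -/

section Positivity

/-- A set of reals each point of which has a left neighbourhood of fixed length in which the set is
null is itself null. -/
theorem volume_eq_zero_of_forall_inter_Ioo {T : Set ℝ} {ε : ℝ} (hε : 0 < ε)
    (h : ∀ s ∈ T, volume (T ∩ Ioo (s - ε) s) = 0) : volume T = 0 := by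
  -- By Lindelöf, countably many of the intervals already cover their union.
  obtain ⟨C, hCT, hC, hU⟩ := TopologicalSpace.isOpen_biUnion_countable T
    (fun s => Ioo (s - ε) s) fun s _ => isOpen_Ioo
  set U := ⋃ s ∈ T, Ioo (s - ε) s with hUdef
  have h1 : volume (T ∩ U) = 0 := by
    rw [← hU, inter_iUnion₂]
    exact (measure_biUnion_null_iff hC).2 fun s hs => h s (hCT hs)
  have h2 : (T \ U).Countable := by
    -- Two uncovered points are at least `ε` apart, since otherwise the smaller lies in the interval
    -- to the left of the larger.
    have hinj : InjOn (fun s : ℝ => ⌊s / ε⌋) (T \ U) := by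
      have aux : ∀ s ∈ T \ U, ∀ s' ∈ T \ U, ⌊s / ε⌋ = ⌊s' / ε⌋ → s' ≤ s := by
        intro s hs s' hs' hss'
        by_contra hlt
        push Not at hlt
        have h3 : s ≤ s' - ε := by
          by_contra h4
          push Not at h4
          exact hs.2 (mem_biUnion hs'.1 ⟨h4, hlt⟩)
        have h5 : s / ε + 1 ≤ s' / ε := by
          rw [← div_self hε.ne', ← add_div]
          exact div_le_div_of_nonneg_right (by linarith) hε.le
        have h6 := Int.floor_le_floor h5
        rw [Int.floor_add_one] at h6
        omega
      exact fun s hs s' hs' hss' => le_antisymm (aux s' hs' s hs hss'.symm) (aux s hs s' hs' hss')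
    exact (mapsTo_univ _ _).countable_of_injOn hinj countable_univ
  rw [← inter_union_sdiff T U]
  exact measure_union_null h1 (h2.measure_zero _)

variable {n : ℕ} {f : EuclideanSpace ℝ (Fin n) → EuclideanSpace ℝ (Fin n)}
  {φ : ℝ → EuclideanSpace ℝ (Fin n) → EuclideanSpace ℝ (Fin n)}
  {X B : Set (EuclideanSpace ℝ (Fin n))}

theorem volume_preimage_eq_zero (hφ : IsFlow f φ) (hf : ContDiff ℝ 1 f) (t : ℝ)
    {Z : Set (EuclideanSpace ℝ (Fin n))} (hZ : volume Z = 0) : volume (φ t ⁻¹' Z) = 0 := by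
  have h : φ t ⁻¹' Z = φ (-t) '' Z := by
    ext x
    constructor
    · exact fun hx => ⟨φ t x, hx, hφ.neg_apply hf t x⟩
    · rintro ⟨y, hy, rfl⟩
      rwa [mem_preimage, hφ.apply_neg hf]
  rw [h]
  exact addHaar_image_eq_zero_of_differentiableOn_of_addHaar_eq_zero volume
    (hφ.differentiable hf (-t)).differentiableOn hZ

/-- Almost every point of `B` was in `B` during a set of times of positive measure in the recent
past. -/
theorem ae_volume_recent_ne_zero (hφ : IsFlow f φ) (hf : ContDiff ℝ 1 f) (hB : MeasurableSet B)
    {ε : ℝ} (hε : 0 < ε) :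
    volume {y | y ∈ B ∧ volume {s | s ∈ Ioo 0 ε ∧ φ (-s) y ∈ B} = 0} = 0 := by
  set Z := {y | y ∈ B ∧ volume {s | s ∈ Ioo 0 ε ∧ φ (-s) y ∈ B} = 0} with hZ
  have hback : Measurable fun q : EuclideanSpace ℝ (Fin n) × ℝ => φ (-q.2) q.1 :=
    ((hφ.continuous hf).comp (by fun_prop : Continuous fun q : EuclideanSpace ℝ (Fin n) × ℝ =>
      (-q.2, q.1))).measurable
  have hZm : MeasurableSet Z := by
    have hm : MeasurableSet {q : EuclideanSpace ℝ (Fin n) × ℝ | q.2 ∈ Ioo 0 ε ∧ φ (-q.2) q.1 ∈ B} :=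
      (measurable_snd measurableSet_Ioo).inter (hback hB)
    exact hB.inter (measurable_measure_prodMk_left hm (measurableSet_singleton 0))
  -- Along one orbit, the times spent in `Z` satisfy the hypothesis of the one-dimensional lemma, by
  -- the very definition of `Z`.
  have horbit : ∀ y, volume {s | φ s y ∈ Z} = 0 := by
    intro y
    refine volume_eq_zero_of_forall_inter_Ioo hε fun s hs => ?_
    have h1 := (Measure.measurePreserving_sub_left volume s).quasiMeasurePreserving.preimage_null
      hs.2
    refine measure_mono_null (fun u hu => ?_) h1
    have h2 : φ (-(s - u)) (φ s y) = φ u y := by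
      rw [← hφ.add hf]
      congr 1
      ring
    refine ⟨⟨by linarith [hu.2.2], by linarith [hu.2.1]⟩, ?_⟩
    rw [h2]
    exact hu.1.1
  have hprod : MeasurableSet {q : ℝ × EuclideanSpace ℝ (Fin n) | φ q.1 q.2 ∈ Z} :=
    (hφ.continuous hf).measurable hZm
  have h3 : ((volume : Measure ℝ).prod (volume : Measure (EuclideanSpace ℝ (Fin n))))
      {q | φ q.1 q.2 ∈ Z} = 0 := by
    rw [Measure.prod_apply_symm hprod]
    exact (lintegral_congr horbit).trans lintegral_zero
  -- By Fubini some slice `φ_s⁻¹(Z)` is null; flow maps preserve null sets, so `Z` is null too.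
  obtain ⟨s, hs⟩ := ((Measure.measure_prod_null hprod).1 h3).exists
  have h4 := volume_preimage_eq_zero hφ hf (-s) hs
  refine measure_mono_null (fun y hy => ?_) h4
  change φ s (φ (-s) y) ∈ Z
  rwa [hφ.apply_neg hf]

theorem perronFrobenius_indicator_pos (hφ : IsFlow f φ) (hf : ContDiff ℝ 1 f) {t : ℝ}
    {x : EuclideanSpace ℝ (Fin n)} (h : Alive φ X (-t) x) (hx : φ (-t) x ∈ B) :
    0 < perronFrobenius φ X t (B.indicator 1) x := by
  rw [perronFrobenius, if_pos h, indicator_of_mem hx, Pi.one_apply, one_mul]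
  exact inv_pos.2 (abs_pos.2 (hφ.det_fderiv_ne_zero hf _ _))

theorem ae_rhoB_pos (hφ : IsFlow f φ) (hf : ContDiff ℝ 1 f) (hB : MeasurableSet B)
    (hfin : ∀ᵐ x, rhoOn φ X B (Ioi 0) x < ⊤) {t : ℝ} (ht : 0 ≤ t) :
    ∀ᵐ x, Alive φ X (-t) x → φ (-t) x ∈ B → 0 < rhoB φ X B x := by
  have h1 : ∀ k : ℕ, ∀ᵐ x, x ∉ φ (-t) ⁻¹' {y | y ∈ B ∧
      volume {s | s ∈ Ioo 0 (1 / ((k : ℝ) + 1)) ∧ φ (-s) y ∈ B} = 0} := fun k =>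
    measure_eq_zero_iff_ae_notMem.1 (volume_preimage_eq_zero hφ hf (-t)
      (ae_volume_recent_ne_zero hφ hf hB (by positivity)))
  filter_upwards [hfin, ae_all_iff.2 h1] with x hx hk hal hxB
  -- Survival is open, so the backward trajectory lives a little beyond `-t`. In this extra time it
  -- meets `B` for a positive measure of times, which also covers `t = 0`.
  have h2 : ∀ᶠ s in 𝓝 (0 : ℝ), Alive φ X (-t - s) x := by
    have hc : Continuous fun s : ℝ => (-t - s, x) := by fun_prop
    exact hc.continuousAt.eventually ((isOpen_alive hφ hf).mem_nhds (by simpa using hal))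
  obtain ⟨ε, hε, hb⟩ := Metric.eventually_nhds_iff_ball.1 h2
  obtain ⟨k, hkε⟩ := exists_nat_one_div_lt hε
  have h3 : volume {s | s ∈ Ioo 0 (1 / ((k : ℝ) + 1)) ∧ φ (-s) (φ (-t) x) ∈ B} ≠ 0 :=
    fun h => hk k ⟨hxB, h⟩
  rw [rhoB, setIntegral_pos_iff_support_of_nonneg_ae
    (Eventually.of_forall fun t => perronFrobenius_indicator_nonneg t x)
    (integrableOn_perronFrobenius hφ hf hB hx)]
  rw [← measure_preimage_add volume (-t)] at h3
  refine (pos_iff_ne_zero.2 h3).trans_le (measure_mono fun u hu => ?_)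
  obtain ⟨⟨hu1, hu2⟩, hu3⟩ := hu
  rw [← hφ.add hf] at hu3
  have e : -(-t + u) + -t = -u := by ring
  rw [e] at hu3
  have hal' := hb (-t + u) (by
    rw [Metric.mem_ball, Real.dist_eq, sub_zero, abs_of_pos hu1]
    exact hu2.trans hkε)
  have e2 : -t - (-t + u) = -u := by ring
  rw [e2] at hal'
  refine ⟨(perronFrobenius_indicator_pos hφ hf hal' hu3).ne', ?_⟩
  change 0 < u
  linarith

end Positivity

/-! ### The stationary equation by integration along orbits. -/

section Weak

variable {n : ℕ} {f : EuclideanSpace ℝ (Fin n) → EuclideanSpace ℝ (Fin n)}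
  {φ : ℝ → EuclideanSpace ℝ (Fin n) → EuclideanSpace ℝ (Fin n)}
  {X B : Set (EuclideanSpace ℝ (Fin n))}

theorem rhoB_eq_zero_of_notMem (hφ : IsFlow f φ) (hf : ContDiff ℝ 1 f) (hB : MeasurableSet B)
    {x : EuclideanSpace ℝ (Fin n)} (hx : x ∉ interior X) : rhoB φ X B x = 0 := by
  rw [rhoB_eq_toReal hφ hf hB, rhoOn_eq_zero_of_notMem hφ hx, ENNReal.toReal_zero]

theorem integrableOn_rhoB (hφ : IsFlow f φ) (hf : ContDiff ℝ 1 f) (hB : MeasurableSet B)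
    (hBX : B ⊆ X) (hX : IsCompact X) (hstab : AEUniformlyStable f φ X) {δ : ℝ} (hδ : 0 < δ) :
    IntegrableOn (rhoB φ X B) (X \ Metric.ball 0 δ) := by
  rw [funext (rhoB_eq_toReal hφ hf hB)]
  exact integrable_toReal_of_lintegral_ne_top (measurable_rhoOn hφ hf hB _).aemeasurable
    (setLIntegral_rhoOn_lt_top hφ hf hB hBX hX hstab hδ).ne

/-- The measure lives on `X` and is finite off the ball where `G` vanishes, and `G` is bounded on
`X`. -/
theorem integrable_withDensity_rhoOn (hφ : IsFlow f φ) (hf : ContDiff ℝ 1 f)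
    (hB : MeasurableSet B) (hBX : B ⊆ X) (hX : IsCompact X) (hstab : AEUniformlyStable f φ X)
    {G : EuclideanSpace ℝ (Fin n) → ℝ} (hG : Continuous G) {δ : ℝ} (hδ : 0 < δ)
    (hG0 : ∀ x ∈ Metric.ball 0 δ, G x = 0) :
    Integrable G (volume.withDensity (rhoOn φ X B (Ioi 0))) := by
  have hA : MeasurableSet (X \ Metric.ball 0 δ) := hX.measurableSet.diff measurableSet_ball
  have hm := measurable_rhoOn (X := X) hφ hf hB (Ioi 0)
  obtain ⟨C, hC⟩ := hX.exists_bound_of_continuousOn hG.continuousOn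
  have h1 : IntegrableOn G (X \ Metric.ball 0 δ) (volume.withDensity (rhoOn φ X B (Ioi 0))) := by
    refine Measure.integrableOn_of_bounded (M := C) ?_ hG.aestronglyMeasurable ?_
    · rw [withDensity_apply _ hA]
      exact (setLIntegral_rhoOn_lt_top hφ hf hB hBX hX hstab hδ).ne
    · exact (ae_restrict_iff' hA).2 (Eventually.of_forall fun x hx => hC x hx.1)
  refine ((integrable_indicator_iff hA).2 h1).congr ?_
  refine (ae_withDensity_iff hm).2 (Eventually.of_forall fun x hx => ?_)
  by_cases hxA : x ∈ X \ Metric.ball 0 δ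
  · exact indicator_of_mem hxA _
  · rw [indicator_of_notMem hxA]
    have hxX : x ∈ X := by
      by_contra h
      exact hx (rhoOn_eq_zero_of_notMem hφ fun h' => h (interior_subset h'))
    exact (hG0 x (by_contra fun h => hxA ⟨hxX, h⟩)).symm

theorem integrable_indicator_aliveFrom (hφ : IsFlow f φ) (hf : ContDiff ℝ 1 f)
    (hB : MeasurableSet B) (hBX : B ⊆ X) (hX : IsCompact X) (hstab : AEUniformlyStable f φ X)
    {G : EuclideanSpace ℝ (Fin n) → ℝ} (hG : Continuous G) {δ : ℝ} (hδ : 0 < δ)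
    (hG0 : ∀ x ∈ Metric.ball 0 δ, G x = 0) :
    Integrable ((aliveFrom φ X B).indicator fun q => G (φ q.1 q.2))
      (((volume : Measure ℝ).restrict (Ioi 0)).prod volume) := by
  have h := integrable_withDensity_rhoOn hφ hf hB hBX hX hstab hG hδ hG0
  rw [withDensity_rhoOn hφ hf hB, integrable_map_measure hG.aestronglyMeasurable
    (hφ.continuous hf).measurable.aemeasurable] at h
  exact (integrable_indicator_iff (measurableSet_aliveFrom hφ hf hB)).2 h

theorem setIntegral_rhoB_mul (hφ : IsFlow f φ) (hf : ContDiff ℝ 1 f)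
    (hB : MeasurableSet B) (hBX : B ⊆ X) (hX : IsCompact X) (hstab : AEUniformlyStable f φ X)
    (hfin : ∀ᵐ x, rhoOn φ X B (Ioi 0) x < ⊤)
    {G : EuclideanSpace ℝ (Fin n) → ℝ} (hG : Continuous G) {δ : ℝ} (hδ : 0 < δ)
    (hG0 : ∀ x ∈ Metric.ball 0 δ, G x = 0) :
    ∫ x in X, rhoB φ X B x * G x = ∫ y, ∫ t in Ioi (0 : ℝ),
      (aliveFrom φ X B).indicator (fun q => G (φ q.1 q.2)) (t, y) := by
  rw [setIntegral_eq_integral_of_forall_compl_eq_zero fun x hx => by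
    rw [rhoB_eq_zero_of_notMem hφ hf hB fun h => hx (interior_subset h), zero_mul]]
  simp only [rhoB_eq_toReal hφ hf hB, ← smul_eq_mul]
  rw [← integral_withDensity_eq_integral_toReal_smul (measurable_rhoOn hφ hf hB _) hfin,
    withDensity_rhoOn hφ hf hB, integral_map (hφ.continuous hf).measurable.aemeasurable
      hG.aestronglyMeasurable, ← integral_indicator (measurableSet_aliveFrom hφ hf hB),
    integral_prod_symm _ (integrable_indicator_aliveFrom hφ hf hB hBX hX hstab hG hδ hG0)]

/-- A trajectory that has stayed in `X` does not arrive at an inflow point. -/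
theorem notMem_inflow_of_arrival (hφ : IsFlow f φ) {y : EuclideanSpace ℝ (Fin n)} {T : ℝ}
    (hT : 0 < T) (h : ∀ s ∈ Ioo 0 T, φ s y ∈ X) : φ T y ∉ inflow f X := by
  rintro ⟨hfr, η, ⟨-, r, hr, ⟨c, hc, hgrad⟩, hloc⟩, hin⟩
  set p := φ T y with hp
  have hrp : 0 ≤ r p := by
    by_contra hneg
    push Not at hneg
    have h1 : ∀ᶠ x in 𝓝 p, x ∈ X := by
      filter_upwards [hloc, hr.continuousAt.eventually (gt_mem_nhds hneg)] with x hx hx'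
      exact hx.2 hx'.le
    exact hfr.2 (mem_interior_iff_mem_nhds.2 h1)
  have hd : HasDerivAt (fun s => r (φ s y)) (fderiv ℝ r p (f p)) T :=
    HasFDerivAt.comp_hasDerivAt (f := fun s => φ s y) T
      (hr.differentiableAt one_ne_zero).hasFDerivAt (hφ.hasDerivAt y T)
  have hdneg : fderiv ℝ r p (f p) < 0 := by
    rw [← inner_gradient_left, hgrad, real_inner_smul_left, real_inner_comm]
    exact mul_neg_of_pos_of_neg hc hin
  have hslope := (hasDerivWithinAt_iff_tendsto_slope' (s := Iio T) (by simp)).1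
    (hd.hasDerivWithinAt (s := Iio T))
  -- Before arrival `r ≤ 0`, and `r p ≥ 0` at arrival, so left difference quotients are nonnegative,
  -- against the derivative `c (f p · η) < 0`.
  have hev : ∀ᶠ s in 𝓝[<] T, 0 ≤ slope (fun s => r (φ s y)) T s := by
    filter_upwards [Ioo_mem_nhdsLT hT,
      nhdsWithin_le_nhds ((hφ.continuous_time y).continuousAt.eventually hloc)] with s hs hs'
    have h1 : r (φ s y) ≤ 0 := hs'.1 (h s hs)
    rw [slope_def_field]
    exact div_nonneg_of_nonpos (by linarith) (by linarith [hs.2])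
  exact absurd (ge_of_tendsto hslope hev) (not_le.2 hdneg)

/-- The fundamental theorem of calculus along a trajectory up to its exit time. -/
theorem integral_alive_orbit (hφ : IsFlow f φ) (hf : ContDiff ℝ 1 f)
    {ψ : EuclideanSpace ℝ (Fin n) → ℝ} (hψ : ContDiff ℝ 1 ψ)
    (hψX : ∀ x ∈ frontier X \ inflow f X, ψ x = 0) {y : EuclideanSpace ℝ (Fin n)} (hyB : y ∈ B)
    (hy : y ∈ interior X)
    (hint : IntegrableOn (fun t => (aliveFrom φ X B).indicator (fun q => ψ (φ q.1 q.2)) (t, y))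
      (Ioi 0))
    (hint' : IntegrableOn (fun t => (aliveFrom φ X B).indicator
      (fun q => fderiv ℝ ψ (φ q.1 q.2) (f (φ q.1 q.2))) (t, y)) (Ioi 0)) :
    ∫ t in Ioi (0 : ℝ), (aliveFrom φ X B).indicator
      (fun q => fderiv ℝ ψ (φ q.1 q.2) (f (φ q.1 q.2))) (t, y) = -ψ y := by
  have hd : ∀ t, HasDerivAt (fun s => ψ (φ s y)) (fderiv ℝ ψ (φ t y) (f (φ t y))) t := fun t =>
    HasFDerivAt.comp_hasDerivAt (f := fun s => φ s y) t
      (hψ.differentiable one_ne_zero _).hasFDerivAt (hφ.hasDerivAt y t)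
  have hdc : Continuous fun t => fderiv ℝ ψ (φ t y) (f (φ t y)) :=
    ((hψ.continuous_fderiv one_ne_zero).comp (hφ.continuous_time y)).clm_apply
      (hf.continuous.comp (hφ.continuous_time y))
  -- The infimum of `S` is the exit time; the exit point lies on the frontier but not in the inflow
  -- part, so `ψ` vanishes there.
  set S := {t : ℝ | 0 ≤ t ∧ φ t y ∉ interior X} with hS
  by_cases hne : S.Nonempty
  · have hSc : IsClosed S := isClosed_Ici.inter
      (isOpen_interior.preimage (hφ.continuous_time y)).isClosed_compl
    have hbdd : BddBelow S := ⟨0, fun t ht => ht.1⟩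
    obtain ⟨hT0, hTX⟩ := hSc.csInf_mem hne hbdd
    set T := sInf S with hTdef
    have hT : 0 < T := by
      refine lt_of_le_of_ne hT0 fun h => hTX ?_
      rwa [← h, hφ.zero]
    have hin : ∀ s, 0 ≤ s → s < T → φ s y ∈ interior X := fun s hs hsT => by
      by_contra h
      exact absurd (csInf_le hbdd (show s ∈ S from ⟨hs, h⟩)) (not_le.2 hsT)
    have halive : ∀ t ∈ Ioi (0 : ℝ), (t, y) ∈ aliveFrom φ X B ↔ t ∈ Iio T := by
      intro t ht
      constructor
      · intro h
        by_contra h2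
        rw [mem_Iio, not_lt] at h2
        exact hTX (h.2 T (mem_uIcc.2 (Or.inl ⟨hT0, h2⟩)))
      · intro h
        refine ⟨hyB, fun s hs => ?_⟩
        rw [uIcc_of_le (le_of_lt ht)] at hs
        exact hin s hs.1 (hs.2.trans_lt h)
    have hfr : φ T y ∈ frontier X := by
      refine ⟨?_, hTX⟩
      have h1 : T ∈ closure (Ico 0 T) := by
        rw [closure_Ico hT.ne]
        exact ⟨hT0, le_rfl⟩
      exact map_mem_closure (f := fun t => φ t y) (hφ.continuous_time y) h1 fun s hs =>
        interior_subset (hin s hs.1 hs.2)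
    have hψT : ψ (φ T y) = 0 := hψX _ ⟨hfr, notMem_inflow_of_arrival hφ hT fun s hs =>
      interior_subset (hin s hs.1.le hs.2)⟩
    have h2 : ∫ t in Ioi (0 : ℝ), (aliveFrom φ X B).indicator
        (fun q => fderiv ℝ ψ (φ q.1 q.2) (f (φ q.1 q.2))) (t, y) =
        ∫ t in Ioi (0 : ℝ), (Iio T).indicator (fun t => fderiv ℝ ψ (φ t y) (f (φ t y))) t := by
      refine setIntegral_congr_fun measurableSet_Ioi fun t ht => ?_
      by_cases h : t ∈ Iio T
      · rw [indicator_of_mem h, indicator_of_mem ((halive t ht).2 h)]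
      · rw [indicator_of_notMem h, indicator_of_notMem fun h' => h ((halive t ht).1 h')]
    rw [h2, setIntegral_indicator measurableSet_Iio, Ioi_inter_Iio, ← integral_Ioc_eq_integral_Ioo,
      ← intervalIntegral.integral_of_le hT0,
      intervalIntegral.integral_eq_sub_of_hasDerivAt (fun t _ => hd t)
        (hdc.intervalIntegrable _ _), hψT, hφ.zero, zero_sub]
  · have hin : ∀ s, 0 ≤ s → φ s y ∈ interior X := fun s hs => by
      by_contra h
      exact hne ⟨s, hs, h⟩
    have halive : ∀ t ∈ Ioi (0 : ℝ), (t, y) ∈ aliveFrom φ X B := by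
      refine fun t ht => ⟨hyB, fun s hs => ?_⟩
      rw [uIcc_of_le (le_of_lt ht)] at hs
      exact hin s hs.1
    have h1 : ∀ G : EuclideanSpace ℝ (Fin n) → ℝ, EqOn
        (fun t => (aliveFrom φ X B).indicator (fun q => G (φ q.1 q.2)) (t, y))
        (fun t => G (φ t y)) (Ioi 0) := fun G t ht => by
      simp only
      rw [indicator_of_mem (halive t ht)]
    have h2 := h1 fun x => fderiv ℝ ψ x (f x)
    rw [setIntegral_congr_fun measurableSet_Ioi h2]
    rw [integrableOn_congr_fun (h1 ψ) measurableSet_Ioi] at hint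
    -- Without exit, `ψ` along the orbit and its derivative are both integrable, which forces `ψ →
    -- 0` at infinity.
    rw [integrableOn_congr_fun h2 measurableSet_Ioi] at hint'
    rw [integral_Ioi_of_hasDerivAt_of_tendsto' (fun t _ => hd t) hint'
      (tendsto_zero_of_hasDerivAt_of_integrableOn_Ioi (fun t _ => hd t) hint' hint), hφ.zero,
      zero_sub]

theorem isWeakSolution_rhoB (hφ : IsFlow f φ) (hf : ContDiff ℝ 1 f)
    (hB : MeasurableSet B) (hBX : B ⊆ X) (hX : IsCompact X) (hX0 : volume (frontier X) = 0)
    (hstab : AEUniformlyStable f φ X) (hfin : ∀ᵐ x, rhoOn φ X B (Ioi 0) x < ⊤) :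
    IsWeakSolution f X (B.indicator 1) (rhoB φ X B) := by
  refine ⟨fun δ hδ => integrableOn_rhoB hφ hf hB hBX hX hstab hδ, fun ψ hψ h0 hψX => ?_⟩
  obtain ⟨δ, hδ, hball⟩ := Metric.mem_nhds_iff.1
    ((isClosed_tsupport ψ).isOpen_compl.mem_nhds h0)
  have hψ0 : ∀ x ∈ Metric.ball 0 δ, ψ x = 0 := fun x hx => image_eq_zero_of_notMem_tsupport (hball hx)
  have hG0 : ∀ x ∈ Metric.ball 0 δ, fderiv ℝ ψ x (f x) = 0 := fun x hx => by
    rw [image_eq_zero_of_notMem_tsupport (f := fderiv ℝ ψ)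
      fun h => hball hx (tsupport_fderiv_subset ℝ h)]
    rfl
  have hG : Continuous fun x => fderiv ℝ ψ x (f x) :=
    (hψ.continuous_fderiv one_ne_zero).clm_apply hf.continuous
  rw [setIntegral_rhoB_mul hφ hf hB hBX hX hstab hfin hG hδ hG0]
  have h1 := (integrable_indicator_aliveFrom hφ hf hB hBX hX hstab hψ.continuous hδ
    hψ0).prod_left_ae
  have h2 := (integrable_indicator_aliveFrom hφ hf hB hBX hX hstab hG hδ hG0).prod_left_ae
  -- Discarding the null frontier, trajectories from `B` start in the interior.
  have h3 : ∀ᵐ y, y ∉ frontier X := measure_eq_zero_iff_ae_notMem.1 hX0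
  rw [setIntegral_eq_integral_of_forall_compl_eq_zero fun x hx => by
    rw [indicator_of_notMem fun h => hx (hBX h), zero_mul], ← integral_neg]
  refine integral_congr_ae ?_
  filter_upwards [h1, h2, h3] with y hy1 hy2 hy3
  by_cases hyB : y ∈ B
  · have hyX : y ∈ interior X := by
      by_contra h
      exact hy3 ⟨subset_closure (hBX hyB), h⟩
    rw [integral_alive_orbit hφ hf hψ hψX hyB hyX hy1 hy2]
    simp [hyB]
  · have h4 : ∀ t : ℝ, (t, y) ∉ aliveFrom φ X B := fun t h => hyB h.1
    simp [h4, hyB]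

end Weak

/-! ### Comparison with an arbitrary nonnegative weak solution. -/

section Minimality

/-- Parametric integrals of jointly continuously differentiable families are `C¹`. -/
theorem contDiff_one_parametric_intervalIntegral {E F : Type*} [NormedAddCommGroup E]
    [NormedSpace ℝ E] [ProperSpace E] [NormedAddCommGroup F] [NormedSpace ℝ F]
    {u : E → ℝ → F} {u' : E → ℝ → E →L[ℝ] F} (hu : Continuous u.uncurry)
    (hu' : Continuous u'.uncurry) (h : ∀ x t, HasFDerivAt (fun x => u x t) (u' x t) x) (a b : ℝ) :
    ContDiff ℝ 1 fun x => ∫ t in a..b, u x t := by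
  refine contDiff_one_iff_hasFDerivAt.2 ⟨fun x => ∫ t in a..b, u' x t,
    intervalIntegral.continuous_parametric_intervalIntegral_of_continuous' hu' a b, fun x => ?_⟩
  obtain ⟨C, hC⟩ := ((isCompact_closedBall x 1).prod
    (isCompact_uIcc (a := a) (b := b))).exists_bound_of_continuousOn hu'.continuousOn
  have hux : ∀ x, Continuous (u x) := fun x => hu.comp (Continuous.prodMk_right x)
  refine intervalIntegral.hasFDerivAt_integral_of_dominated_of_fderiv_le (bound := fun _ => C)
    (Metric.closedBall_mem_nhds x one_pos)
    (Eventually.of_forall fun y => (hux y).aestronglyMeasurable)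
    ((hux x).intervalIntegrable _ _)
    (hu'.comp (Continuous.prodMk_right x)).aestronglyMeasurable
    (Eventually.of_forall fun t ht y hy => hC (y, t) ⟨hy, uIoc_subset_uIcc ht⟩)
    intervalIntegrable_const (Eventually.of_forall fun t _ y _ => h y t)

/-- A pointwise inequality can be tested against nonnegative compactly supported `C¹` functions. -/
theorem ae_le_of_forall_contDiff_lintegral_le {E : Type*} [NormedAddCommGroup E]
    [InnerProductSpace ℝ E] [FiniteDimensional ℝ E] [MeasurableSpace E] [BorelSpace E]
    {V : Set E} (hV : IsOpen V) {a b : E → ENNReal} (ha : Measurable a)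
    (hb : AEMeasurable b (volume.restrict V)) (hfin : ∫⁻ x in V, b x ≠ ⊤)
    (h : ∀ g : E → ℝ, ContDiff ℝ 1 g → HasCompactSupport g → tsupport g ⊆ V → (∀ x, 0 ≤ g x) →
      ∫⁻ x in V, a x * ENNReal.ofReal (g x) ≤ ∫⁻ x in V, b x * ENNReal.ofReal (g x)) :
    a ≤ᵐ[volume.restrict V] b := by
  have := FiniteDimensional.proper ℝ E
  have hcompact : ∀ C, IsCompact C → C ⊆ V → ∫⁻ x in C, a x ≤ ∫⁻ x in C, b x := by
    intro C hC hCV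
    obtain ⟨L, hL, hCL, hLV⟩ := exists_compact_between hC hV hCV
    -- `G` equals `1` exactly on `C`, so its powers decrease to the indicator of `C`; exponents `k +
    -- 1` avoid the constant power `0`.
    obtain ⟨G, hGs, hGr, hGsupp, hG1⟩ := exists_contMDiff_support_eq_eq_one_iff
      (modelWithCornersSelf ℝ E) (n := 1) (isOpen_interior (s := L)) hC.isClosed hCL
    have hGd : ContDiff ℝ 1 G := hGs.contDiff
    have hG01 : ∀ x, 0 ≤ G x ∧ G x ≤ 1 := fun x => hGr (mem_range_self x)
    have hpow : ∀ k : ℕ, ContDiff ℝ 1 fun x => G x ^ (k + 1) := fun k => hGd.pow _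
    have hts : ∀ k : ℕ, tsupport (fun x => G x ^ (k + 1)) ⊆ L := fun k => by
      refine closure_minimal (fun x hx => ?_) hL.isClosed
      have hx' : x ∈ Function.support G := fun h0 => hx (by simp [h0])
      rw [hGsupp] at hx'
      exact interior_subset hx'
    have hle : ∀ k : ℕ, ∫⁻ x in C, a x ≤ ∫⁻ x in V, b x * ENNReal.ofReal (G x ^ (k + 1)) := by
      intro k
      refine le_trans ?_ (h _ (hpow k) (hL.of_isClosed_subset (isClosed_tsupport _) (hts k))
        ((hts k).trans hLV) fun x => pow_nonneg (hG01 x).1 _)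
      calc ∫⁻ x in C, a x = ∫⁻ x in C, a x * ENNReal.ofReal (G x ^ (k + 1)) :=
            setLIntegral_congr_fun hC.measurableSet fun x hx => by simp [(hG1 x).1 hx]
        _ ≤ _ := lintegral_mono_set hCV
    have hlim : Tendsto (fun k : ℕ => ∫⁻ x in V, b x * ENNReal.ofReal (G x ^ (k + 1))) atTop
        (𝓝 (∫⁻ x in V, C.indicator b x)) := by
      refine tendsto_lintegral_filter_of_dominated_convergence' b (Eventually.of_forall fun k =>
        hb.mul (hpow k).continuous.measurable.ennreal_ofReal.aemeasurable)
        (Eventually.of_forall fun k => Eventually.of_forall fun x => ?_) hfin ?_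
      · exact mul_le_of_le_one_right' (ENNReal.ofReal_le_one.2
          (pow_le_one₀ (hG01 x).1 (hG01 x).2))
      · have hbfin : ∀ᵐ x ∂volume.restrict V, b x < ⊤ := ae_lt_top' hb hfin
        filter_upwards [hbfin] with x hx
        by_cases hxC : x ∈ C
        · simp [hxC, (hG1 x).1 hxC]
        · rw [indicator_of_notMem hxC]
          have hlt : G x < 1 := lt_of_le_of_ne (hG01 x).2 fun h1 => hxC ((hG1 x).2 h1)
          have h1 := (tendsto_pow_atTop_nhds_zero_of_lt_one (hG01 x).1 hlt).comp
            (tendsto_add_atTop_nat 1)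
          have h2 := ENNReal.Tendsto.const_mul (a := b x) (ENNReal.tendsto_ofReal h1)
            (Or.inr hx.ne)
          simpa [Function.comp_def] using h2
    have h3 := ge_of_tendsto hlim (Eventually.of_forall hle)
    rwa [setLIntegral_indicator hC.measurableSet, inter_eq_left.2 hCV] at h3
  by_contra hnot
  -- If the inequality failed on a set of positive measure, inner regularity would give a compact
  -- set contradicting `hcompact`.
  set N := {x | x ∈ V ∧ hb.mk b x < a x} with hN
  have hNm : MeasurableSet N := hV.measurableSet.inter
    (measurableSet_lt hb.measurable_mk ha)
  have hN0 : 0 < volume N := by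
    refine pos_iff_ne_zero.2 fun h0 => hnot ?_
    have h1 : ∀ᵐ x ∂volume.restrict V, x ∉ N :=
      ae_restrict_of_ae (measure_eq_zero_iff_ae_notMem.1 h0)
    filter_upwards [h1, ae_restrict_mem hV.measurableSet, hb.ae_eq_mk] with x hx hxV hxb
    rw [hxb]
    exact not_lt.1 fun hlt => hx ⟨hxV, hlt⟩
  obtain ⟨C, hCN, hC, hC0⟩ := hNm.exists_lt_isCompact hN0
  have hCV : C ⊆ V := fun x hx => (hCN hx).1
  have hbC : ∫⁻ x in C, b x = ∫⁻ x in C, hb.mk b x :=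
    lintegral_congr_ae (ae_restrict_of_ae_restrict_of_subset hCV hb.ae_eq_mk)
  have hbfinC : ∫⁻ x in C, hb.mk b x ≠ ⊤ := by
    rw [← hbC]
    exact ((lintegral_mono_set hCV).trans_lt hfin.lt_top).ne
  have hlt := setLIntegral_strict_mono hC.measurableSet hC0.ne' ha hbfinC
    (Eventually.of_forall fun x hx => (hCN hx).2)
  rw [← hbC] at hlt
  exact absurd (hcompact C hC hCV) (not_le.2 hlt)

variable {n : ℕ} {f : EuclideanSpace ℝ (Fin n) → EuclideanSpace ℝ (Fin n)}
  {φ : ℝ → EuclideanSpace ℝ (Fin n) → EuclideanSpace ℝ (Fin n)}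
  {X B : Set (EuclideanSpace ℝ (Fin n))}

theorem IsFlow.apply_equilibrium (hφ : IsFlow f φ) (hf : ContDiff ℝ 1 f)
    {p : EuclideanSpace ℝ (Fin n)} (hp : f p = 0) (t : ℝ) : φ t p = p := by
  refine eqOn_Ioo_of_hasDerivAt hf (a := -(|t| + 1)) (b := |t| + 1) (t₀ := 0)
    ⟨by linarith [abs_nonneg t], by linarith [abs_nonneg t]⟩ (γ := fun t => φ t p)
    (δ := fun _ => p) (fun s _ => hφ.hasDerivAt p s) (fun s _ => ?_) (hφ.zero p)
    ⟨by linarith [neg_abs_le t], by linarith [le_abs_self t]⟩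
  rw [hp]
  exact hasDerivAt_const s p

theorem contDiff_orbit_integral (hφ : IsFlow f φ) (hf : ContDiff ℝ 1 f)
    {g : EuclideanSpace ℝ (Fin n) → ℝ} (hg : ContDiff ℝ 1 g) (τ : ℝ) :
    ContDiff ℝ 1 fun x => ∫ t in (0 : ℝ)..τ, g (φ t x) := by
  have hswap : Continuous fun q : EuclideanSpace ℝ (Fin n) × ℝ => (q.2, q.1) := continuous_swap
  refine contDiff_one_parametric_intervalIntegral (u := fun x t => g (φ t x))
    (u' := fun x t => (fderiv ℝ g (φ t x)).comp (fderiv ℝ (φ t) x))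
    (hg.continuous.comp ((hφ.continuous hf).comp hswap))
    (((hg.continuous_fderiv one_ne_zero).comp ((hφ.continuous hf).comp hswap)).clm_comp
      ((hφ.continuous_fderiv hf).comp hswap)) (fun x t => ?_) 0 τ
  exact HasFDerivAt.comp x (hg.differentiable one_ne_zero _).hasFDerivAt
    (hφ.differentiable hf t x).hasFDerivAt

/-- Moving `x` along the flow by time `s` shifts the window of integration to `[s, τ + s]`, so only
the endpoint values survive differentiation. -/
theorem fderiv_orbit_integral (hφ : IsFlow f φ) (hf : ContDiff ℝ 1 f)
    {g : EuclideanSpace ℝ (Fin n) → ℝ} (hg : ContDiff ℝ 1 g) (τ : ℝ)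
    (x : EuclideanSpace ℝ (Fin n)) :
    fderiv ℝ (fun x => ∫ t in (0 : ℝ)..τ, g (φ t x)) x (f x) = g (φ τ x) - g x := by
  have hc : Continuous fun t => g (φ t x) := hg.continuous.comp (hφ.continuous_time x)
  have h1 : HasDerivAt (fun s => ∫ t in (0 : ℝ)..τ, g (φ t (φ s x)))
      (fderiv ℝ (fun x => ∫ t in (0 : ℝ)..τ, g (φ t x)) x (f x)) 0 := by
    have h2 := ((contDiff_orbit_integral hφ hf hg τ).differentiable one_ne_zero (φ 0 x)).hasFDerivAt
    have h3 := HasFDerivAt.comp_hasDerivAt (f := fun s => φ s x) 0 h2 (hφ.hasDerivAt x 0)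
    rwa [hφ.zero] at h3
  have h4 : (fun s => ∫ t in (0 : ℝ)..τ, g (φ t (φ s x))) = fun s =>
      (∫ t in (0 : ℝ)..(τ + s), g (φ t x)) - ∫ t in (0 : ℝ)..s, g (φ t x) := by
    ext s
    simp only [← hφ.add hf]
    rw [intervalIntegral.integral_comp_add_right (fun t => g (φ t x)) s, zero_add,
      intervalIntegral.integral_interval_sub_left (hc.intervalIntegrable _ _)
        (hc.intervalIntegrable _ _)]
  have h5 : HasDerivAt (fun s => (∫ t in (0 : ℝ)..(τ + s), g (φ t x)) -
      ∫ t in (0 : ℝ)..s, g (φ t x)) (g (φ τ x) - g (φ 0 x)) 0 := by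
    refine HasDerivAt.sub ?_ (hc.integral_hasStrictDerivAt 0 0).hasDerivAt
    have h6 := (hc.integral_hasStrictDerivAt 0 (τ + 0)).hasDerivAt.comp_const_add τ 0
    simpa using h6
  rw [h4] at h1
  rw [h1.unique h5, hφ.zero]

theorem integrableOn_mul_of_eventually_eq_zero {X : Set (EuclideanSpace ℝ (Fin n))}
    (hX : IsCompact X) {ρ : EuclideanSpace ℝ (Fin n) → ℝ}
    (hρ : ∀ δ > 0, IntegrableOn ρ (X \ Metric.ball 0 δ)) {h : EuclideanSpace ℝ (Fin n) → ℝ}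
    (hh : Continuous h) (h0 : ∀ᶠ x in 𝓝 0, h x = 0) : IntegrableOn (fun x => ρ x * h x) X := by
  obtain ⟨δ, hδ, hball⟩ := Metric.eventually_nhds_iff_ball.1 h0
  obtain ⟨C, hC⟩ := hX.exists_bound_of_continuousOn hh.continuousOn
  have hA : MeasurableSet (X \ Metric.ball 0 δ) := hX.measurableSet.diff measurableSet_ball
  have h1 : IntegrableOn (fun x => ρ x * h x) (X \ Metric.ball 0 δ) :=
    Integrable.mul_bdd (c := C) (hρ δ hδ) hh.aestronglyMeasurable
      ((ae_restrict_iff' hA).2 (Eventually.of_forall fun x hx => hC x hx.1))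
  refine IntegrableOn.of_forall_sdiff_eq_zero h1 hX.measurableSet fun x hx => ?_
  have hxb : x ∈ Metric.ball 0 δ := by_contra fun h => hx.2 ⟨hx.1, h⟩
  rw [hball x hxb, mul_zero]

/-- Test the equation with `ψ = ∫_0^τ g ∘ φ_t dt`. Two nonnegative quantities are given away: `∫ ρ
(g ∘ φ_τ)`, and the contribution of trajectories that left `X` in the meantime. -/
theorem lintegral_rhoOn_Ioc_mul_le (hφ : IsFlow f φ) (hf : ContDiff ℝ 1 f)
    (hB : MeasurableSet B) (hBX : B ⊆ X) (hX : IsCompact X) (hf0 : f 0 = 0)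
    {ρ : EuclideanSpace ℝ (Fin n) → ℝ} (hρ : IsWeakSolution f X (B.indicator 1) ρ)
    (hρ0 : 0 ≤ᵐ[volume.restrict X] ρ) {τ : ℝ} (hτ : 0 ≤ τ) {g : EuclideanSpace ℝ (Fin n) → ℝ}
    (hg : ContDiff ℝ 1 g) (hgc : HasCompactSupport g) (hg0 : ∀ x, 0 ≤ g x)
    (hgA : ∀ x ∈ tsupport g, Alive φ X (-τ) x) (hg00 : 0 ∉ tsupport g) :
    ∫⁻ x, rhoOn φ X B (Ioc 0 τ) x * ENNReal.ofReal (g x) ≤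
      ∫⁻ x in X, ENNReal.ofReal (ρ x) * ENNReal.ofReal (g x) := by
  set ψ : EuclideanSpace ℝ (Fin n) → ℝ := fun x => ∫ t in (0 : ℝ)..τ, g (φ t x) with hψdef
  have hψ : ContDiff ℝ 1 ψ := contDiff_orbit_integral hφ hf hg τ
  -- The backward sweep of the support of `g` contains the support of `ψ`. Backward survival keeps
  -- it inside the interior, and it misses `0` because `0` is an equilibrium; hence `ψ` is
  -- admissible.
  set K := (fun q : ℝ × EuclideanSpace ℝ (Fin n) => φ (-q.1) q.2) '' (Icc 0 τ ×ˢ tsupport g)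
    with hK
  have hKc : IsCompact K := (isCompact_Icc.prod hgc).image
    ((hφ.continuous hf).comp (by fun_prop : Continuous fun q : ℝ × EuclideanSpace ℝ (Fin n) =>
      (-q.1, q.2)))
  have hψK : ∀ x, x ∉ K → ψ x = 0 := by
    intro x hx
    have h1 : ∀ t ∈ uIcc 0 τ, g (φ t x) = 0 := fun t ht => by
      by_contra h2
      rw [uIcc_of_le hτ] at ht
      exact hx ⟨(t, φ t x), ⟨ht, subset_tsupport g h2⟩, hφ.neg_apply hf t x⟩
    rw [hψdef]
    simp only
    rw [intervalIntegral.integral_congr h1, intervalIntegral.integral_zero]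
  have hKX : K ⊆ interior X := by
    rintro _ ⟨⟨t, x⟩, ⟨ht, hx⟩, rfl⟩
    refine hgA x hx (-t) (mem_uIcc.2 (Or.inr ⟨?_, ?_⟩))
    · linarith [ht.2]
    · linarith [ht.1]
  have hK0 : 0 ∉ K := by
    rintro ⟨⟨t, x⟩, ⟨ht, hx⟩, h⟩
    have h1 : x = 0 := by
      have h2 := hφ.apply_neg hf t x
      simp only at h
      rw [h, hφ.apply_equilibrium hf hf0] at h2
      exact h2.symm
    exact hg00 (h1 ▸ hx)
  have hψt : tsupport ψ ⊆ K :=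
    closure_minimal (fun x hx => by_contra fun h => hx (hψK x h)) hKc.isClosed
  have hweak := hρ.weak ψ hψ (fun h => hK0 (hψt h)) fun x hx => hψK x fun h => hx.1.2 (hKX h)
  have hev : ∀ᶠ x in 𝓝 (0 : EuclideanSpace ℝ (Fin n)), g x = 0 := by
    filter_upwards [(isClosed_tsupport g).isOpen_compl.mem_nhds hg00] with x hx
    exact image_eq_zero_of_notMem_tsupport hx
  have hev' : ∀ᶠ x in 𝓝 (0 : EuclideanSpace ℝ (Fin n)), g (φ τ x) = 0 :=
    (hφ.continuous_apply hf τ).continuousAt.eventually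
      (by rwa [hφ.apply_equilibrium hf hf0])
  have hI := integrableOn_mul_of_eventually_eq_zero hX hρ.integrable hg.continuous hev
  have hI' : IntegrableOn (fun x => ρ x * g (φ τ x)) X :=
    integrableOn_mul_of_eventually_eq_zero hX hρ.integrable
    (hg.continuous.comp (hφ.continuous_apply hf τ)) hev'
  simp only [hψdef, fderiv_orbit_integral hφ hf hg, mul_sub] at hweak
  rw [integral_sub hI' hI, neg_sub] at hweak
  have hpos : 0 ≤ ∫ x in X, ρ x * g (φ τ x) :=
    integral_nonneg_of_ae (by filter_upwards [hρ0] with x hx using mul_nonneg hx (hg0 _))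
  have hBψ : ∫ x in X, B.indicator 1 x * ψ x = ∫ x in B, ψ x := by
    have e : (fun x => B.indicator (1 : EuclideanSpace ℝ (Fin n) → ℝ) x * ψ x) = B.indicator ψ := by
      ext x
      by_cases hx : x ∈ B <;> simp [hx]
    rw [e, setIntegral_indicator hB, inter_eq_right.2 hBX]
  have hψ0 : ∀ x, 0 ≤ ψ x := fun x =>
    intervalIntegral.integral_nonneg hτ fun t _ => hg0 _
  have hψB : IntegrableOn ψ B :=
    ((hψ.continuous.continuousOn.integrableOn_compact hX).mono_set hBX)
  have hgφ : Measurable fun q : ℝ × EuclideanSpace ℝ (Fin n) => ENNReal.ofReal (g (φ q.1 q.2)) :=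
    (hg.continuous.comp (hφ.continuous hf)).measurable.ennreal_ofReal
  calc ∫⁻ x, rhoOn φ X B (Ioc 0 τ) x * ENNReal.ofReal (g x)
      = ∫⁻ t in Ioc 0 τ, ∫⁻ y in {y | y ∈ B ∧ Alive φ X t y}, ENNReal.ofReal (g (φ t y)) :=
        lintegral_rhoOn_mul hφ hf hB _ hg.continuous.measurable.ennreal_ofReal
    _ ≤ ∫⁻ t in Ioc 0 τ, ∫⁻ y in B, ENNReal.ofReal (g (φ t y)) :=
        lintegral_mono fun t => lintegral_mono_set fun y hy => hy.1
    _ = ∫⁻ y in B, ∫⁻ t in Ioc 0 τ, ENNReal.ofReal (g (φ t y)) :=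
        lintegral_lintegral_swap hgφ.aemeasurable
    _ = ∫⁻ y in B, ENNReal.ofReal (ψ y) := lintegral_congr fun y => by
        have hc : Continuous fun t => g (φ t y) := hg.continuous.comp (hφ.continuous_time y)
        rw [hψdef]
        simp only
        rw [intervalIntegral.integral_of_le hτ, ofReal_integral_eq_lintegral_ofReal
          (hc.integrableOn_Ioc) (Eventually.of_forall fun t => hg0 _)]
    _ = ENNReal.ofReal (∫ y in B, ψ y) :=
        (ofReal_integral_eq_lintegral_ofReal hψB (Eventually.of_forall hψ0)).symm
    _ ≤ ENNReal.ofReal (∫ x in X, ρ x * g x) := by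
        refine ENNReal.ofReal_le_ofReal ?_
        rw [← hBψ]
        simp only [hψdef]
        linarith
    _ = ∫⁻ x in X, ENNReal.ofReal (ρ x * g x) :=
        ofReal_integral_eq_lintegral_ofReal hI
          (by filter_upwards [hρ0] with x hx using mul_nonneg hx (hg0 _))
    _ = _ := by
        refine lintegral_congr_ae ?_
        filter_upwards [hρ0] with x hx
        exact ENNReal.ofReal_mul hx

theorem ae_rhoOn_Ioc_le (hφ : IsFlow f φ) (hf : ContDiff ℝ 1 f)
    (hB : MeasurableSet B) (hBX : B ⊆ X) (hX : IsCompact X) (hf0 : f 0 = 0)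
    {ρ : EuclideanSpace ℝ (Fin n) → ℝ} (hρ : IsWeakSolution f X (B.indicator 1) ρ)
    (hρ0 : 0 ≤ᵐ[volume.restrict X] ρ) {τ : ℝ} (hτ : 0 ≤ τ) {δ : ℝ} (hδ : 0 < δ) :
    ∀ᵐ x, Alive φ X (-τ) x → δ < ‖x‖ → rhoOn φ X B (Ioc 0 τ) x ≤ ENNReal.ofReal (ρ x) := by
  set V := {x | Alive φ X (-τ) x ∧ δ < ‖x‖} with hVdef
  have hV : IsOpen V := ((isOpen_alive hφ hf).preimage (Continuous.prodMk_right (-τ))).inter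
    (isOpen_lt continuous_const continuous_norm)
  have hVX : V ⊆ X := fun x hx => interior_subset (hx.1.mem_interior hφ)
  have hρV : IntegrableOn ρ V := (hρ.integrable δ hδ).mono_set fun x hx =>
    ⟨hVX hx, by simpa using hx.2.le⟩
  have h := ae_le_of_forall_contDiff_lintegral_le hV (measurable_rhoOn (X := X) hφ hf hB (Ioc 0 τ))
    (b := fun x => ENNReal.ofReal (ρ x)) hρV.aestronglyMeasurable.aemeasurable.ennreal_ofReal
    hρV.lintegral_lt_top.ne fun g hg hgc hgV hg0 => ?_
  · filter_upwards [(ae_restrict_iff' hV.measurableSet).1 h] with x hx h1 h2 using hx ⟨h1, h2⟩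
  · have h1 := lintegral_rhoOn_Ioc_mul_le hφ hf hB hBX hX hf0 hρ hρ0 hτ hg hgc hg0
      (fun x hx => (hgV hx).1) fun h0 => by
        have := (hgV h0).2
        rw [norm_zero] at this
        linarith
    refine (setLIntegral_le_lintegral _ _).trans (h1.trans ((setLIntegral_le_lintegral _ _).trans
      (le_of_eq ?_)))
    rw [← lintegral_indicator hV.measurableSet]
    refine lintegral_congr fun x => ?_
    by_cases hx : x ∈ V
    · rw [indicator_of_mem hx]
    · rw [indicator_of_notMem hx, image_eq_zero_of_notMem_tsupport fun h' => hx (hgV h')]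
      simp

/-- `P_t χ_B(x)` vanishes once `x` is not alive back to time `-t`, so rational survival times
exhaust the integral. Rationals keep the number of exceptional null sets countable. -/
theorem rhoOn_Ioi_le (hφ : IsFlow f φ) (hf : ContDiff ℝ 1 f) {x : EuclideanSpace ℝ (Fin n)}
    {c : ENNReal} (h : ∀ q : ℚ, 0 < (q : ℝ) → Alive φ X (-(q : ℝ)) x →
      rhoOn φ X B (Ioc 0 (q : ℝ)) x ≤ c) : rhoOn φ X B (Ioi 0) x ≤ c := by
  set ι := {q : ℚ // 0 < (q : ℝ) ∧ Alive φ X (-(q : ℝ)) x} with hι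
  set U : Set ℝ := ⋃ q : ι, Ioc 0 ((q : ℚ) : ℝ) with hU
  have hUm : MeasurableSet U := MeasurableSet.iUnion fun q => measurableSet_Ioc
  have hsub : rhoOn φ X B (Ioi 0) x ≤ rhoOn φ X B U x := by
    rw [rhoOn, rhoOn, ← lintegral_indicator measurableSet_Ioi, ← lintegral_indicator hUm]
    refine lintegral_mono fun t => ?_
    by_cases htU : t ∈ U
    · rw [indicator_of_mem htU]
      exact indicator_le_self _ _ t
    · by_cases ht : t ∈ Ioi (0 : ℝ)
      · rw [indicator_of_mem ht]
        have hna : ¬Alive φ X (-t) x := by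
          intro hal
          have hc : Continuous fun s : ℝ => (-s, x) := by fun_prop
          have hev := hc.continuousAt.eventually ((isOpen_alive hφ hf).mem_nhds hal)
          obtain ⟨ε, hε, hb⟩ := Metric.eventually_nhds_iff_ball.1 hev
          obtain ⟨q, hq1, hq2⟩ := exists_rat_btwn (lt_add_of_pos_right t hε)
          refine htU (mem_iUnion.2 ⟨⟨q, lt_trans ht hq1, hb q ?_⟩, ht, hq1.le⟩)
          rw [Metric.mem_ball, Real.dist_eq, abs_lt]
          constructor <;> linarith
        rw [perronFrobenius, if_neg hna, ENNReal.ofReal_zero]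
        exact zero_le
      · rw [indicator_of_notMem ht]
        exact zero_le
  refine hsub.trans ?_
  have hdir : Directed (· ⊆ ·) fun q : ι => Ioc (0 : ℝ) ((q : ℚ) : ℝ) := by
    intro p q
    rcases le_total (p : ℚ) (q : ℚ) with h1 | h1
    · exact ⟨q, Ioc_subset_Ioc_right (by exact_mod_cast h1), subset_rfl⟩
    · exact ⟨p, subset_rfl, Ioc_subset_Ioc_right (by exact_mod_cast h1)⟩
  rw [rhoOn, hU, setLIntegral_iUnion_of_directed _ hdir]
  exact iSup_le fun q => h q q.2.1 q.2.2

theorem rhoB_le_of_isWeakSolution (hn : 1 ≤ n) (hφ : IsFlow f φ) (hf : ContDiff ℝ 1 f)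
    (hB : MeasurableSet B) (hBX : B ⊆ X) (hX : IsCompact X) (hf0 : f 0 = 0)
    {ρ : EuclideanSpace ℝ (Fin n) → ℝ} (hρ : IsWeakSolution f X (B.indicator 1) ρ)
    (hρ0 : 0 ≤ᵐ[volume.restrict X] ρ) : rhoB φ X B ≤ᵐ[volume.restrict X] ρ := by
  have : Nonempty (Fin n) := ⟨⟨0, hn⟩⟩
  have h1 : ∀ᵐ x : EuclideanSpace ℝ (Fin n), x ≠ 0 := by simp [ae_iff]
  have h2 : ∀ q : ℚ, ∀ k : ℕ, ∀ᵐ x, 0 < (q : ℝ) → Alive φ X (-(q : ℝ)) x →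
      1 / ((k : ℝ) + 1) < ‖x‖ → rhoOn φ X B (Ioc 0 (q : ℝ)) x ≤ ENNReal.ofReal (ρ x) := by
    intro q k
    by_cases hq : 0 < (q : ℝ)
    · filter_upwards [ae_rhoOn_Ioc_le hφ hf hB hBX hX hf0 hρ hρ0 hq.le
        (δ := 1 / ((k : ℝ) + 1)) (by positivity)] with x hx _ using hx
    · exact Eventually.of_forall fun x h => absurd h hq
  have h3 := ae_all_iff.2 fun q => ae_all_iff.2 (h2 q)
  filter_upwards [hρ0, ae_restrict_of_ae h1, ae_restrict_of_ae h3] with x hx hx0 hall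
  obtain ⟨k, hk⟩ := exists_nat_one_div_lt (norm_pos_iff.2 hx0)
  rw [rhoB_eq_toReal hφ hf hB]
  exact ENNReal.toReal_le_of_le_ofReal hx (rhoOn_Ioi_le hφ hf fun q hq hal => hall q k hq hal hk)

end Minimality

end Advection

theorem mainTheorem8 (n : ℕ) (hn : 1 ≤ n)
    (f : EuclideanSpace ℝ (Fin n) → EuclideanSpace ℝ (Fin n)) (hf : ContDiff ℝ 1 f)
    (φ : ℝ → EuclideanSpace ℝ (Fin n) → EuclideanSpace ℝ (Fin n)) (hφ : Advection.IsFlow f φ)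
    (X : Set (EuclideanSpace ℝ (Fin n))) (hX : IsCompact X) (hX0 : volume (frontier X) = 0)
    (hstab : Advection.AEUniformlyStable f φ X)
    (B : Set (EuclideanSpace ℝ (Fin n))) (hB : MeasurableSet B) (hBX : B ⊆ X) :
    -- the integral that defines `ρ_B` converges almost everywhere
    (∀ᵐ x ∂volume.restrict X,
      IntegrableOn (fun t => Advection.perronFrobenius φ X t (B.indicator 1) x) (Ioi 0)) ∧
    -- the infinite-time gramian is the multiplication operator by `ρ_B`, pointwise ...
    (∀ z : Lp ℝ 2 ((volume : Measure (EuclideanSpace ℝ (Fin n))).restrict X),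
      ∀ᵐ x ∂volume.restrict X,
        Tendsto (fun τ => Advection.gramian φ X B τ z x) atTop
          (𝓝 (Advection.rhoB φ X B x * z x))) ∧
    -- ... and as a densely defined operator in `L²(X)`, with its maximal domain
    (∀ z w : Lp ℝ 2 ((volume : Measure (EuclideanSpace ℝ (Fin n))).restrict X),
      (z, w) ∈ Advection.infiniteGramianGraph φ X B ↔
        w =ᵐ[volume.restrict X] fun x => Advection.rhoB φ X B x * z x) ∧
    Dense {z : Lp ℝ 2 ((volume : Measure (EuclideanSpace ℝ (Fin n))).restrict X) |
      ∃ w, (z, w) ∈ Advection.infiniteGramianGraph φ X B} ∧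
    -- `ρ_B` is nonnegative, and positive wherever the flow carries `B`
    (∀ x, 0 ≤ Advection.rhoB φ X B x) ∧
    (∀ t : ℝ, 0 ≤ t → ∀ᵐ x ∂volume.restrict X,
      Advection.Alive φ X (-t) x → φ (-t) x ∈ B → 0 < Advection.rhoB φ X B x) ∧
    -- `ρ_B` solves the stationary equation with zero inflow boundary condition
    Advection.IsWeakSolution f X (B.indicator 1) (Advection.rhoB φ X B) ∧
    -- and it is the smallest nonnegative solution
    (∀ ρ : EuclideanSpace ℝ (Fin n) → ℝ, Advection.IsWeakSolution f X (B.indicator 1) ρ →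
      0 ≤ᵐ[volume.restrict X] ρ → Advection.rhoB φ X B ≤ᵐ[volume.restrict X] ρ) := by
  have hfin := Advection.ae_rhoOn_lt_top hn hφ hf hB hBX hX hstab
  refine ⟨?_, ?_, ?_, ?_, ?_, ?_, ?_, ?_⟩
  · filter_upwards [ae_restrict_of_ae hfin] with x hx
    exact Advection.integrableOn_perronFrobenius hφ hf hB hx
  · intro z
    filter_upwards [ae_restrict_of_ae hfin] with x hx
    exact Advection.tendsto_gramian hφ hf hB z hx
  · exact Advection.mem_infiniteGramianGraph_iff hφ hf hB hfin
  · exact Advection.dense_infiniteGramian_domain hφ hf hB hfin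
  · exact Advection.rhoB_nonneg
  · exact fun t ht => ae_restrict_of_ae (Advection.ae_rhoB_pos hφ hf hB hfin ht)
  · exact Advection.isWeakSolution_rhoB hφ hf hB hBX hX hX0 hstab hfin
  · exact fun ρ hρ hρ0 =>
      Advection.rhoB_le_of_isWeakSolution hn hφ hf hB hBX hX hstab.1 hρ hρ0
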